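/- **Notation.** Let $p\ge 1$, $\gamma=(\gamma_1,\dots,\gamma_{p+1})\in\mathbb R^{p+1}$, $N\in\mathbb R$, $n\in\mathbb N_0^p$, $y\in\mathbb R^p$. Write $|n|=n_1+\dots+n_p$, $N_1^k=n_1+\dots+n_k$, $\gamma_1^k=\gamma_1+\dots+\gamma_k$, $Y_1^k=y_1+\dots+y_k$, with $y_{p+1}=N-|y|$ (so $Y_1^{p+1}=N$), and $(x)_k=x(x+1)\cdots(x+k-1)$. Let $$h_n(x;a;b;N)=(a+1)_n(-N)_n\;{}_3F_2\!\left[{-n,\;n+a+b+1,\;-x\atop a+1,\;-N};1\right]$$ (a polynomial in $x,a,b,N$ after cancellation), and let $$H_p(n;y;\gamma;N)=\frac{(-1)^{|n|}}{(-N)_{|n|}\prod_{k=1}^p(\gamma_{k+1}+1)_{n_k}}\prod_{k=1}^p h_{n_k}\bigl(Y_1^k-N_1^{k-1};\,2N_1^{k-1}+\gamma_1^k+k-1;\,\gamma_{k+1};\,Y_1^{k+1}-N_1^{k-1}\bigr)$$ be the multivariable Hahn polynomials of Karlin and McGregor. For $1\le j\le p$ put $$\tilde{\mathfrak L}^y_j=\sum_{1\le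 l\ne m\le j+1}(y_l+\gamma_l+1)\,y_m\,(E_{y_l}E_{y_m}^{-1}-1),$$ where $E_{y_l}$ is the unit shift in $y_l$ and $E_{y_{p+1}}=1$. *Racah operators.* For variables $x_1,\dots,x_{j+1}$ and parameters $\beta_0,\dots,\beta_{j+1}$ let $$\mathcal L_j=\mathcal L_j(x_1,\dots,x_j;\beta_0,\dots,\beta_{j+1};x_{j+1})=\sum_{0\ne\nu\in\{-1,0,1\}^j}(-1)^{|\nu^-|}A_\nu\,\triangle_x^{\nu^+}\nabla_x^{\nu^-},\qquad \triangle_{x_i}=E_{x_i}-1,\quad \nabla_{x_i}=1-E_{x_i}^{-1},$$ where $\nu^{\pm}$ are the positive and negative parts of $\nu$. For $\nu\in\{0,1\}^j$ with nonzero entries at $i_1<\dots<i_s$, $$A_\nu=(x_{i_1}+\beta_{i_1}-\beta_0)(x_{i_1}+\beta_{i_1})\frac{\prod_{k=2}^s(x_{i_k}+x_{i_{k-1}}+\beta_{i_k})(x_{i_k}+x_{i_{k-1}}+\beta_{i_k}+1)}{\prod_{k=1}^s(2x_{i_k}+\beta_{i_k})(2x_{i_k}+\beta_{i_k}+1)}(x_{i_s}+\beta_{j+1}+x_{j+1})(x_{j+1}-x_{i_s}),$$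 and in general $A_\nu$ is obtained from $A_{\nu^++\nu^-}$ by substituting $-x_i-\beta_i$ for $x_i$ whenever $\nu_i=-1$. With $x_{p+1}=N$, the operator $\mathfrak L^n_j$ in the variables $n$ is obtained from $\mathcal L_j$ by the simultaneous substitutions $$\beta_0\mapsto\beta_0,\quad \beta_k\mapsto\beta_0-\beta_{p+2-k}-2N+1\ (1\le k\le p+1),\quad N\mapsto N,$$ $$x_k\mapsto N_1^{p+1-k}+\beta_{p+2-k}-\beta_0+N-1,\quad E_{x_k}\mapsto E_{n_{p+1-k}}E_{n_{p+2-k}}^{-1}\ (1\le k\le p),\quad E_{n_{p+1}}=1.$$ Finally put $\beta_k=\beta_0+\gamma_1^k+k$ for $1\le k\le p+1$, so that $\mathfrak L^n_j$ depends on $\beta_0,\gamma,N$, and define $$\tilde{\mathfrak L}^n_j=\lim_{\beta_0\to\infty}\frac1{\beta_0}\,\mathfrak L^n_j .$$ **Theorem 5.2.** Let $1\le j\le p$, and assume that $H_p(n;y;\gamma;N)$ is defined, that is, $|n|\le N$ if $N\in\mathbb N_0$, and $(\gamma_{k+1}+1)_{n_k}\neq0$ for $k=1,\dots,p$. (a)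 For all $y\in\mathbb R^p$, $$\tilde{\mathfrak L}^y_jH_p(n;y;\gamma;N)=\tilde\mu_j(n)H_p(n;y;\gamma;N),\qquad \tilde\mu_j(n)=-N_1^j\,\bigl(N_1^j+j+\gamma_1+\dots+\gamma_{j+1}\bigr).$$ (b) Call $(\gamma,N)$ *regular at $n$* if $(-N)_{|n|+1}\ne0$, $(\gamma_{k+1}+1)_{|n|+1}\ne0$ for $k=1,\dots,p$, and $2N_1^m+\gamma_1^{m+1}+m\notin\{-1,0,1\}$ for $p+1-j\le m\le p$ (so that the coefficients of $\tilde{\mathfrak L}^n_j$ at $n$ and all the $H_p(n';y;\gamma;N)$ with $|n'|\le|n|+1$ are defined). If $(\gamma,N)$ is regular at $n$, then the limit defining $\tilde{\mathfrak L}^n_j$ exists at $n$ (on every function on $\mathbb Z^p$), and for all $y\in\mathbb R^p$ $$\tilde{\mathfrak L}^n_jH_p(n;y;\gamma;N)=\tilde\kappa_j(y)H_p(n;y;\gamma;N),\qquad \tilde\kappa_j(y)=N-y_1-y_2-\dots-y_{p+1-j}.$$ Here $H_p(\cdot\,;y;\gamma;N)$ may be extended from $\mathbb N_0^p$ to $\mathbb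 Z^p$ by arbitrary values. If $(\gamma,N)$ is not regular at $n$ (for example, if $N=|n|$), the equation holds in the limit: its left-hand side for $(\gamma',N')$ tends to $\tilde\kappa_j(y)H_p(n;y;\gamma;N)$ when $(\gamma',N')\to(\gamma,N)$ through parameters that are regular at $n$. -/

import Mathlib

open Filter Topology

noncomputable section

namespace Hahn

/-- The Pochhammer symbol `(x)_k = x (x+1) ⋯ (x+k-1)`. -/
def poch (x : ℝ) (k : ℕ) : ℝ := (ascPochhammer ℝ k).eval x

/-- The partial sum `v₁ + ⋯ + v_k` of a vector `(v₁, …, v_m)`, whose entry `v_i` is `v ⟨i-1, _⟩`. -/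
def psum {m : ℕ} (v : Fin m → ℝ) (k : ℕ) : ℝ := ∑ i : Fin m, if (i : ℕ) < k then v i else 0

/-! ### The polynomials -/

/-- The one-dimensional Hahn polynomial
`h_n(x;a;b;N) = (a+1)_n (-N)_n ₃F₂(-n, n+a+b+1, -x; a+1, -N; 1)`.
The factors `(a+1)_k (-N)_k` in the denominators of the `₃F₂` are cancelled against
`(a+1)_n (-N)_n`, so that this is a polynomial in all of `x, a, b, N`. -/
def hahn1 (n : ℕ) (x a b N : ℝ) : ℝ :=
  ∑ k ∈ Finset.range (n + 1),
    poch (-(n : ℝ)) k * poch (n + a + b + 1) k * poch (-x) k / (k.factorial : ℝ) *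
      (poch (a + 1 + k) (n - k) * poch (-N + k) (n - k))

/-- The definition of `hahn1` agrees with the hypergeometric one wherever the latter makes sense. -/
theorem hahn1_eq (n : ℕ) (x a b N : ℝ) (ha : poch (a + 1) n ≠ 0) (hN : poch (-N) n ≠ 0) :
    hahn1 n x a b N = poch (a + 1) n * poch (-N) n *
      ∑ k ∈ Finset.range (n + 1), poch (-(n : ℝ)) k * poch (n + a + b + 1) k * poch (-x) k /
        (poch (a + 1) k * poch (-N) k * (k.factorial : ℝ)) := by
  have split : ∀ (z : ℝ) (k : ℕ), k ≤ n → poch z n = poch z k * poch (z + k) (n - k) := by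
    intro z k hk
    obtain ⟨d, rfl⟩ := Nat.exists_eq_add_of_le hk
    have h := congrArg (Polynomial.eval z) (ascPochhammer_mul ℝ k d)
    simpa [poch, Polynomial.eval_comp, mul_comm] using h.symm
  rw [hahn1, Finset.mul_sum]
  refine Finset.sum_congr rfl fun k hk => ?_
  have hk' : k ≤ n := Nat.lt_succ_iff.mp (Finset.mem_range.mp hk)
  have h1 := split (a + 1) k hk'
  have h2 := split (-N) k hk'
  have ha' : poch (a + 1) k ≠ 0 := fun h => ha (by rw [h1, h, zero_mul])
  have hN' : poch (-N) k ≠ 0 := fun h => hN (by rw [h2, h, zero_mul])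
  have hf : (k.factorial : ℝ) ≠ 0 := by exact_mod_cast k.factorial_ne_zero
  rw [h1, h2]
  field_simp

/-- `(y₁, …, y_p)` completed by `y_{p+1} = N - |y|`; thus `psum (compl y N) k` is `Y_1^k` for every
`k ≤ p + 1`, and `Y_1^{p+1} = N`. -/
def compl {p : ℕ} (y : Fin p → ℝ) (N : ℝ) : Fin (p + 1) → ℝ := Fin.snoc y (N - ∑ i, y i)

/-- The multivariable Hahn polynomial `H_p(n;y;γ;N)`. The index `k : Fin p` stands for the factor
number `k + 1` of the product, and `γ` lists `γ₁, …, γ_{p+1}`. -/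
def hahnH {p : ℕ} (n : Fin p → ℕ) (y : Fin p → ℝ) (γ : Fin (p + 1) → ℝ) (N : ℝ) : ℝ :=
  (-1) ^ (∑ i, n i) / (poch (-N) (∑ i, n i) * ∏ k : Fin p, poch (γ k.succ + 1) (n k)) *
    ∏ k : Fin p,
      hahn1 (n k)
        (psum (compl y N) (k + 1) - psum (fun i => (n i : ℝ)) k)
        (2 * psum (fun i => (n i : ℝ)) k + psum γ (k + 1) + (k : ℝ))
        (γ k.succ)
        (psum (compl y N) (k + 2) - psum (fun i => (n i : ℝ)) k)

/-- `H_p(n;y;γ;N)` as a function of `n ∈ ℤ^p`: the Hahn polynomial on `ℕ^p`, and the values of an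
arbitrary function `c` elsewhere. -/
def hahnExt {p : ℕ} (c : (Fin p → ℤ) → ℝ) (y : Fin p → ℝ) (γ : Fin (p + 1) → ℝ) (N : ℝ) :
    (Fin p → ℤ) → ℝ := fun n =>
  if ∀ i, 0 ≤ n i then hahnH (fun i => (n i).toNat) y γ N else c n

/-! ### The operators in `y` -/

/-- The vector `e_{l+1}` of `ℝ^p`, with `e_{p+1} = 0`. -/
def unitVec {p : ℕ} (l : Fin (p + 1)) : Fin p → ℝ := fun i => if i.castSucc = l then 1 else 0

/-- `𝔏̃^y_j = ∑_{1 ≤ l ≠ m ≤ j+1} (y_l + γ_l + 1) y_m (E_{y_l} E_{y_m}⁻¹ - 1)`, where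
`y_{p+1} = N - |y|` and `E_{y_{p+1}} = 1`. -/
def hahnOpY {p : ℕ} (j : ℕ) (γ : Fin (p + 1) → ℝ) (N : ℝ) (f : (Fin p → ℝ) → ℝ)
    (y : Fin p → ℝ) : ℝ :=
  ∑ l : Fin (p + 1), ∑ m : Fin (p + 1),
    if l ≠ m ∧ (l : ℕ) < j + 1 ∧ (m : ℕ) < j + 1 then
      (compl y N l + γ l + 1) * compl y N m * (f (y + unitVec l - unitVec m) - f y)
    else 0

/-! ### The Racah operators

Variables `x₁, x₂, …` and parameters `β₀, β₁, …` are sequences indexed by `ℕ`. A multi-index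
`ν ∈ {-1,0,1}^j` is a function `ν : Fin j → SignType`, and `i : Fin j` stands for the coordinate
number `i + 1`. -/

/-- The coefficient `A_ν` (`ν ≠ 0`) of the Racah operator
`ℒ_j(x₁, …, x_j; β₀, …, β_{j+1}; x_{j+1}) = ∑_{ν ≠ 0} (-1)^{|ν⁻|} A_ν Δ_x^{ν⁺} ∇_x^{ν⁻}`.

If all `ν_i ≥ 0` and `i₁ < ⋯ < i_s` are the indices with `ν_i ≠ 0` then `A_ν` is
`(x_{i₁} + β_{i₁} - β₀) (x_{i₁} + β_{i₁})`
`× ∏_{k=2}^s (x_{i_k} + x_{i_{k-1}} + β_{i_k}) (x_{i_k} + x_{i_{k-1}} + β_{i_k} + 1)`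
`/ ∏_{k=1}^s (2 x_{i_k} + β_{i_k}) (2 x_{i_k} + β_{i_k} + 1)`
`× (x_{i_s} + β_{j+1} + x_{j+1}) (x_{j+1} - x_{i_s})`.
In general `A_ν` is obtained from `A_{|ν|}` by applying the involution `x_i ↦ -x_i - β_i` for every
`i` with `ν_i = -1`. -/
def racahA (j : ℕ) (β x : ℕ → ℝ) (ν : Fin j → SignType) : ℝ :=
  let S : Finset (Fin j) := Finset.univ.filter fun i => ν i ≠ 0
  let B : Fin j → ℝ := fun i => β (i + 1)
  let X : Fin j → ℝ := fun i => if ν i = -1 then -x (i + 1) - β (i + 1) else x (i + 1)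
  -- the only element `i` of the first index set is the least element of `S`
  (∏ i ∈ S.filter (fun i => ∀ k ∈ S, i ≤ k), (X i + B i - β 0) * (X i + B i)) *
  -- pairs of consecutive elements of `S`
  (∏ q ∈ (S ×ˢ S).filter (fun q => q.1 < q.2 ∧ ∀ m ∈ S, ¬(q.1 < m ∧ m < q.2)),
    (X q.2 + X q.1 + B q.2) * (X q.2 + X q.1 + B q.2 + 1)) /
  (∏ i ∈ S, (2 * X i + B i) * (2 * X i + B i + 1)) *
  -- the only element `i` of the last index set is the greatest element of `S`
  (∏ i ∈ S.filter (fun i => ∀ k ∈ S, k ≤ i), (X i + β (j + 1) + x (j + 1)) * (x (j + 1) - X i))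

/-- `𝔟(β₀) = β₀` and `𝔟(β_k) = β₀ - β_{p+2-k} - 2N + 1` for `1 ≤ k ≤ p + 1`. -/
def dualParam (p : ℕ) (β : ℕ → ℝ) (N : ℝ) (k : ℕ) : ℝ :=
  if k = 0 then β 0 else β 0 - β (p + 2 - k) - 2 * N + 1

/-- `𝔟(x_k) = n₁ + ⋯ + n_{p+1-k} + β_{p+2-k} - β₀ + N - 1` for `1 ≤ k ≤ p`, and
`𝔟(x_{p+1}) = 𝔟(N) = N`. -/
def dualVar {p : ℕ} (β : ℕ → ℝ) (N : ℝ) (n : Fin p → ℤ) (k : ℕ) : ℝ :=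
  if k ≤ p then psum (fun i => (n i : ℝ)) (p + 1 - k) + β (p + 2 - k) - β 0 + N - 1 else N

/-- The translation vector of `𝔟(E_{x_k}) = E_{n_{p+1-k}} E_{n_{p+2-k}}⁻¹` for `1 ≤ k ≤ p`, with
`E_{n_{p+1}} = 1`. (The entry `i : Fin p` belongs to the variable `n_{i+1}`.) -/
def dualShift (p k : ℕ) : Fin p → ℤ := fun i =>
  (if (i : ℕ) + 1 = p + 1 - k then 1 else 0) - (if (i : ℕ) + 1 = p + 2 - k then 1 else 0)

/-- The translation operator `F ↦ F(· + v)`. -/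
def translate {p : ℕ} (v : Fin p → ℤ) : Module.End ℝ ((Fin p → ℤ) → ℝ) :=
  LinearMap.funLeft ℝ ℝ fun n => n + v

/-- For the translation `E` by `v`: the forward difference `E - 1` if `s = 1`, the backward
difference `1 - E⁻¹` if `s = -1`, the identity if `s = 0`. -/
def diffOp {p : ℕ} (v : Fin p → ℤ) (s : SignType) : Module.End ℝ ((Fin p → ℤ) → ℝ) :=
  if s = 1 then translate v - 1 else if s = -1 then 1 - translate (-v) else 1

/-- The dual Racah operator `𝔏^n_j = 𝔟(𝔏^x_j)`, where
`𝔏^x_j = ℒ_j(x₁, …, x_j; β₀, …, β_{j+1}; x_{j+1})`, acting on functions on `ℤ^p`. -/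
def racahDualOp {p : ℕ} (j : ℕ) (β : ℕ → ℝ) (N : ℝ) (F : (Fin p → ℤ) → ℝ) (n : Fin p → ℤ) : ℝ :=
  ∑ ν ∈ (Finset.univ : Finset (Fin j → SignType)).filter (fun ν => ν ≠ 0),
    (-1) ^ (Finset.univ.filter fun i => ν i = -1).card *
      racahA j (dualParam p β N) (dualVar β N n) ν *
      (List.ofFn fun i : Fin j => diffOp (dualShift p (i + 1)) (ν i)).prod F n

/-! ### The operators in `n` for the Hahn polynomials -/

/-- The Racah parameters `β_k = β₀ + γ₁ + ⋯ + γ_k + k`. -/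
def hahnParam {p : ℕ} (γ : Fin (p + 1) → ℝ) (β₀ : ℝ) (k : ℕ) : ℝ := β₀ + psum γ k + k

/-- `𝔏̃^n_j = lim_{β₀ → ∞} 𝔏^n_j / β₀`, with `𝔏^n_j` written in terms of `β₀, γ, N`. -/
def hahnOpN {p : ℕ} (j : ℕ) (γ : Fin (p + 1) → ℝ) (N : ℝ) (F : (Fin p → ℤ) → ℝ)
    (n : Fin p → ℤ) : ℝ :=
  limUnder atTop fun β₀ : ℝ => racahDualOp j (hahnParam γ β₀) N F n / β₀

/-- The parameters `(γ, N)` for which, at the point `n`, everything in the equation for `𝔏̃^n_j` is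
defined: the polynomials `H_p(n';y;γ;N)` with `|n'| ≤ |n| + 1`, and the coefficients of `𝔏̃^n_j`,
whose denominators are products of factors `z_m` and `z_m ± 1` with
`z_m = 2(n₁ + ⋯ + n_m) + γ₁ + ⋯ + γ_{m+1} + m`, `p + 1 - j ≤ m ≤ p`. -/
def Regular {p : ℕ} (j : ℕ) (n : Fin p → ℕ) (γ : Fin (p + 1) → ℝ) (N : ℝ) : Prop :=
  poch (-N) ((∑ i, n i) + 1) ≠ 0 ∧
  (∀ k : Fin p, poch (γ k.succ + 1) ((∑ i, n i) + 1) ≠ 0) ∧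
  ∀ m : ℕ, p + 1 - j ≤ m → m ≤ p →
    2 * psum (fun i => (n i : ℝ)) m + psum γ (m + 1) + m ≠ -1 ∧
    2 * psum (fun i => (n i : ℝ)) m + psum γ (m + 1) + m ≠ 0 ∧
    2 * psum (fun i => (n i : ℝ)) m + psum γ (m + 1) + m ≠ 1

end Hahn

end

/-!
The equation in `y` goes by induction on `j`. Splitting off the shifts which involve the last
variable `y_{j+2}` leaves sums of the product of the first `j` factors over single shifts; two
contiguous relations of the univariate Hahn polynomial turn these into multiples of the product,
and what remains is the difference equation in `x` of the factor number `j + 1`.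

For the operators in `n`, the only weight in `A_ν` that involves `β₀` is that of the first index,
and it is affine in `β₀`, which gives the limit. Splitting off the last index of `ν` then yields a
recursion in the number of variables. The weights of a pair of consecutive indices are quadratic
polynomials, so interpolation at the two values of the next variable expresses the operators on
`r + 1` levels through those on `r` levels, applied to a function and to its two neighbours. On a
product of Hahn polynomials this recursion reduces to the three-term recurrence in `n` of a single
factor, and to two companions of it in which the parameter `a` is raised or lowered by `2`.
Non-regular parameters follow by continuity.
-/

noncomputable section

namespace Hahn

open Finset

/-! ### Pochhammer symbols -/

lemma poch_zero (x : ℝ) : poch x 0 = 1 := by simp [poch]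

lemma poch_succ (x : ℝ) (k : ℕ) : poch x (k + 1) = poch x k * (x + k) := by
  simp [poch, ascPochhammer_succ_eval]

lemma poch_succ_left (x : ℝ) (k : ℕ) : poch x (k + 1) = x * poch (x + 1) k := by
  simp [poch, ascPochhammer_succ_left, Polynomial.eval_comp]

lemma mul_poch_add_one (x : ℝ) (k : ℕ) : x * poch (x + 1) k = poch x k * (x + k) := by
  rw [← poch_succ, poch_succ_left]

lemma poch_neg_natCast_of_lt {n k : ℕ} (h : n < k) : poch (-(n : ℝ)) k = 0 := by
  simpa [poch] using ascPochhammer_eval_neg_coe_nat_of_lt (R := ℝ) h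

lemma continuous_poch (k : ℕ) : Continuous fun x : ℝ => poch x k :=
  (ascPochhammer ℝ k).continuous

lemma poch_ne_zero_of_le {x : ℝ} {k l : ℕ} (hkl : k ≤ l) (h : poch x l ≠ 0) : poch x k ≠ 0 := by
  induction hkl with
  | refl => exact h
  | step _ ih => exact ih (left_ne_zero_of_mul (poch_succ x _ ▸ h))

lemma poch_neg_ne_zero {x : ℝ} {k : ℕ} (h : ∀ m : ℕ, x = m → k ≤ m) : poch (-x) k ≠ 0 := by
  induction k with
  | zero => simp [poch_zero]
  | succ k ih =>
    rw [poch_succ]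
    refine mul_ne_zero (ih fun m hm => (Nat.le_succ k).trans (h m hm)) fun h0 => ?_
    exact absurd (h k (by linarith)) (Nat.not_succ_le_self k)

/-! ### Univariate Hahn polynomials -/

/-- The coefficient of `(-x)_k` in `h_n(x;a;b;M)`. It vanishes for `k > n`, even though `n - k` is
then truncated. -/
def hahnCoeff (n k : ℕ) (a b M : ℝ) : ℝ :=
  poch (-(n : ℝ)) k * poch (n + a + b + 1) k / (k.factorial : ℝ) *
    (poch (a + 1 + k) (n - k) * poch (-M + k) (n - k))

lemma hahnCoeff_of_lt {n k : ℕ} (h : n < k) (a b M : ℝ) : hahnCoeff n k a b M = 0 := by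
  simp [hahnCoeff, poch_neg_natCast_of_lt h]

lemma hahnCoeff_add (d k : ℕ) (a b M : ℝ) :
    hahnCoeff (k + d) k a b M = poch (-(k : ℝ) - d) k * poch (k + d + a + b + 1) k /
      (k.factorial : ℝ) * (poch (a + 1 + k) d * poch (-M + k) d) := by
  rw [hahnCoeff, Nat.add_sub_cancel_left, Nat.cast_add, neg_add']

lemma hahnCoeff_self (n : ℕ) (a b M : ℝ) :
    hahnCoeff n n a b M = poch (-(n : ℝ)) n * poch (n + a + b + 1) n / (n.factorial : ℝ) := by
  simp [hahnCoeff, poch_zero]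

lemma hahnCoeff_zero_right (n : ℕ) (a b M : ℝ) :
    hahnCoeff n 0 a b M = poch (a + 1) n * poch (-M) n := by
  simp [hahnCoeff, poch_zero]

lemma hahn1_eq_sum {n m : ℕ} (h : n < m) (x a b M : ℝ) :
    hahn1 n x a b M = ∑ k ∈ range m, hahnCoeff n k a b M * poch (-x) k := by
  have key : hahn1 n x a b M = ∑ k ∈ range (n + 1), hahnCoeff n k a b M * poch (-x) k :=
    sum_congr rfl fun k _ => by rw [hahnCoeff]; ring
  rw [key]
  refine sum_subset (range_subset_range.2 h) fun k _ hk => ?_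
  rw [hahnCoeff_of_lt (by simpa using hk), zero_mul]

lemma hahn1_eq_sum_succ {n m : ℕ} (h : n ≤ m) (x a b M : ℝ) :
    hahn1 n x a b M =
      ∑ k ∈ range m, hahnCoeff n (k + 1) a b M * poch (-x) (k + 1) + hahnCoeff n 0 a b M := by
  rw [hahn1_eq_sum (Nat.lt_succ_of_le h), sum_range_succ', poch_zero, mul_one]

lemma hahn1_zero (x a b M : ℝ) : hahn1 0 x a b M = 1 := by
  simp [hahn1, poch_zero]

lemma hahnCoeff_succ_right {n k : ℕ} (hk : k < n) (a b M : ℝ) :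
    (k + 1) * (k + 1 + a) * (-M + k) * hahnCoeff n (k + 1) a b M =
      (k - n) * (n + a + b + 1 + k) * hahnCoeff n k a b M := by
  obtain ⟨d, rfl⟩ : ∃ d, n = k + 1 + d := Nat.exists_eq_add_of_le hk
  have h : hahnCoeff (k + 1 + d) k a b M = hahnCoeff (k + (d + 1)) k a b M := by
    congr 1; omega
  rw [h, hahnCoeff_add, hahnCoeff_add, poch_succ _ k, poch_succ _ k, Nat.factorial_succ,
    poch_succ_left _ d, poch_succ_left _ d]
  push_cast
  have hf : (k.factorial : ℝ) ≠ 0 := by positivity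
  have hk' : (k : ℝ) + 1 ≠ 0 := by positivity
  rw [show -((k : ℝ) + 1) - d = -k - (d + 1) by ring,
    show (k : ℝ) + 1 + d + a + b + 1 = k + (d + 1) + a + b + 1 by ring,
    show a + 1 + ((k : ℝ) + 1) = a + 1 + k + 1 by ring,
    show -M + ((k : ℝ) + 1) = -M + k + 1 by ring]
  field_simp
  ring

lemma hahn1_eigen (n : ℕ) (x a b M : ℝ) :
    (x + a + 1) * (M - x) * (hahn1 n (x + 1) a b M - hahn1 n x a b M) +
      x * (M - x + b + 1) * (hahn1 n (x - 1) a b M - hahn1 n x a b M) =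
      -(n * (n + a + b + 1)) * hahn1 n x a b M := by
  -- The partial sums satisfy the equation up to a defect supported on the last term.
  have key : ∀ r ≤ n,
      (x + a + 1) * (M - x) * (∑ k ∈ range (r + 1), hahnCoeff n k a b M * poch (-(x + 1)) k -
          ∑ k ∈ range (r + 1), hahnCoeff n k a b M * poch (-x) k) +
      x * (M - x + b + 1) * (∑ k ∈ range (r + 1), hahnCoeff n k a b M * poch (-(x - 1)) k -
          ∑ k ∈ range (r + 1), hahnCoeff n k a b M * poch (-x) k) +
      (n * (n + a + b + 1)) * ∑ k ∈ range (r + 1), hahnCoeff n k a b M * poch (-x) k =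
      - ((r - n) * (n + a + b + 1 + r) * hahnCoeff n r a b M) * poch (-x) r := by
    intro r
    induction r with
    | zero => intro _; simp [poch_zero]
    | succ r ih =>
      intro hr
      have ih := ih (by omega)
      rw [← hahnCoeff_succ_right (by omega)] at ih
      have h0 := mul_poch_add_one (-x) r
      have h1 : poch (-(x + 1)) (r + 1) = -(x + 1) * poch (-x) r := by
        rw [poch_succ_left]; ring_nf
      have h2 : poch (-(x - 1)) (r + 1) = poch (-x + 1) r * (-x + 1 + r) := by
        rw [poch_succ]; ring_nf
      simp only [sum_range_succ _ (r + 1), h1, h2, poch_succ (-x) r]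
      push_cast at ih ⊢
      linear_combination ih - (M - x + b + 1) * hahnCoeff n (r + 1) a b M * (-x + 1 + r) * h0
  have h := key n le_rfl
  simp only [← hahn1_eq_sum n.lt_succ_self] at h
  linear_combination h

lemma hahn1_minus (n : ℕ) (x a b M : ℝ) :
    x * hahn1 n (x - 1) a b (M - 1) + (M - x) * hahn1 n x a b (M - 1) =
      (M - n) * hahn1 n x a b M := by
  simp only [hahn1_eq_sum n.lt_succ_self, mul_sum, ← sum_add_distrib]
  refine sum_congr rfl fun k hk => ?_
  obtain ⟨d, rfl⟩ := Nat.exists_eq_add_of_le (mem_range_succ_iff.1 hk)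
  rw [hahnCoeff_add, hahnCoeff_add]
  have h1 := mul_poch_add_one (-x) k
  have h2 := mul_poch_add_one (-M + k) d
  rw [show -(M - 1) + (k : ℝ) = -M + k + 1 by ring, show -(x - 1) = -x + 1 by ring]
  push_cast
  generalize poch (-(k : ℝ) - d) k * poch (k + d + a + b + 1) k / (k.factorial : ℝ) = P
  linear_combination (-P * poch (a + 1 + k) d * poch (-M + k + 1) d) * h1 -
    P * poch (a + 1 + k) d * poch (-x) k * h2

lemma hahnCoeff_raise {n k : ℕ} (hk : k ≤ n + 1) (a b M : ℝ) :
    (2 * n + a + b + 3) * hahnCoeff (n + 1) k a b M =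
      (n + a + b + 2) * hahnCoeff (n + 1) k (a + 1) b M +
        (n + 1) * (n + 1 + b) * (M - n) * hahnCoeff n k (a + 1) b M := by
  obtain rfl | hk := hk.eq_or_lt
  · rw [hahnCoeff_of_lt n.lt_succ_self, hahnCoeff_self, hahnCoeff_self]
    have h := mul_poch_add_one (n + 1 + a + b + 1) (n + 1)
    push_cast at *
    rw [show (n : ℝ) + 1 + (a + 1) + b + 1 = n + 1 + a + b + 1 + 1 by ring]
    linear_combination (-(poch (-((n : ℝ) + 1)) (n + 1) / ((n + 1).factorial : ℝ))) * h
  · obtain ⟨d, rfl⟩ := Nat.exists_eq_add_of_le (Nat.le_of_lt_succ hk)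
    rw [add_assoc k d 1, hahnCoeff_add, hahnCoeff_add, hahnCoeff_add]
    have h1 := mul_poch_add_one (-(k : ℝ) - (d + 1)) k
    have h2 := mul_poch_add_one (k + (d + 1) + a + b + 1) k
    push_cast
    rw [poch_succ_left (a + 1 + k) d, poch_succ (-M + k) d, poch_succ (a + 1 + 1 + k) d,
      show a + 1 + (k : ℝ) + 1 = a + 1 + 1 + k by ring,
      show (k : ℝ) + (d + 1) + (a + 1) + b + 1 = k + (d + 1) + a + b + 1 + 1 by ring,
      show (k : ℝ) + d + (a + 1) + b + 1 = k + (d + 1) + a + b + 1 by ring,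
      show -(k : ℝ) - d = -k - (d + 1) + 1 by ring]
    generalize poch (-(k : ℝ) - (d + 1)) k = P at *
    generalize poch (-(k : ℝ) - (d + 1) + 1) k = P' at *
    generalize poch (k + (d + 1) + a + b + 1) k = Q at *
    generalize poch (k + (d + 1) + a + b + 1 + 1) k = Q' at *
    generalize poch (a + 1 + 1 + k) d = A
    generalize poch (-M + k) d = B
    field_simp
    linear_combination (-(P * A * B * (a + 2 + k + d) * (k + d - M))) * h2 +
      ((k + d + 1 + b) * (M - k - d) * Q * A * B) * h1

lemma hahn1_raise (n : ℕ) (x a b M : ℝ) :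
    (2 * n + a + b + 3) * hahn1 (n + 1) x a b M =
      (n + a + b + 2) * hahn1 (n + 1) x (a + 1) b M +
        (n + 1) * (n + 1 + b) * (M - n) * hahn1 n x (a + 1) b M := by
  simp only [hahn1_eq_sum (show n + 1 < n + 2 by omega), hahn1_eq_sum (show n < n + 2 by omega),
    mul_sum, ← sum_add_distrib]
  refine sum_congr rfl fun k hk => ?_
  linear_combination poch (-x) k * hahnCoeff_raise (mem_range_succ_iff.1 hk) a b M

lemma hahnCoeff_lower_shift {n k : ℕ} (hk : k ≤ n) (a b M : ℝ) :
    hahnCoeff (n + 1) (k + 1) (a - 1) b (M + 1) +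
        (a + n) * (M - n + 1) * hahnCoeff n (k + 1) (a - 1) b (M + 1) =
      -((2 * n + a + b + 1) * hahnCoeff n k a b M) := by
  obtain rfl | hk := hk.eq_or_lt
  · rw [hahnCoeff_of_lt k.lt_succ_self, hahnCoeff_self, hahnCoeff_self, poch_succ_left, poch_succ,
      Nat.factorial_succ]
    push_cast
    rw [show -((k : ℝ) + 1) + 1 = -k by ring,
      show (k : ℝ) + 1 + (a - 1) + b + 1 = k + a + b + 1 by ring]
    field_simp
    ring
  · obtain ⟨d, rfl⟩ := Nat.exists_eq_add_of_le (Nat.succ_le_of_lt hk)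
    have e : hahnCoeff (k + 1 + d) k a b M = hahnCoeff (k + (d + 1)) k a b M := by
      congr 1; omega
    rw [Nat.succ_eq_add_one, e, add_assoc (k + 1) d 1, hahnCoeff_add, hahnCoeff_add, hahnCoeff_add]
    push_cast
    rw [show -((k : ℝ) + 1) - d = -k - (d + 1) by ring,
      show -((k : ℝ) + 1) - (d + 1) = -k - (d + 1) - 1 by ring,
      show (k : ℝ) + 1 + (d + 1) + (a - 1) + b + 1 = k + (d + 1) + a + b + 1 by ring,
      show (k : ℝ) + 1 + d + (a - 1) + b + 1 = k + (d + 1) + a + b by ring,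
      show a - 1 + 1 + ((k : ℝ) + 1) = a + 1 + k by ring,
      show -(M + 1) + ((k : ℝ) + 1) = -M + k by ring,
      poch_succ (-k - (d + 1)) k, poch_succ (k + (d + 1) + a + b + 1) k,
      poch_succ_left (-k - (d + 1) - 1) k, poch_succ_left (k + (d + 1) + a + b) k,
      poch_succ (a + 1 + k) d, poch_succ (-M + k) d, Nat.factorial_succ,
      show -(k : ℝ) - (d + 1) - 1 + 1 = -k - (d + 1) by ring]
    push_cast
    field_simp
    ring

lemma hahn1_lower_shift (n : ℕ) (x a b M : ℝ) :
    (2 * n + a + b + 1) * (x + 1) * hahn1 n x a b M =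
      hahn1 (n + 1) (x + 1) (a - 1) b (M + 1) +
        (a + n) * (M - n + 1) * hahn1 n (x + 1) (a - 1) b (M + 1) := by
  have h0 : hahnCoeff (n + 1) 0 (a - 1) b (M + 1) +
      (a + n) * (M - n + 1) * hahnCoeff n 0 (a - 1) b (M + 1) = 0 := by
    simp only [hahnCoeff_zero_right, poch_succ, sub_add_cancel]
    ring
  rw [hahn1_eq_sum n.lt_succ_self, hahn1_eq_sum_succ (le_refl (n + 1)),
    hahn1_eq_sum_succ (Nat.le_succ n), mul_add _ (∑ _ ∈ _, _), add_add_add_comm, h0, add_zero,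
    mul_sum, mul_sum, ← sum_add_distrib]
  refine sum_congr rfl fun k hk => ?_
  rw [poch_succ_left, show -(x + 1) + 1 = -x by ring]
  linear_combination
    (x + 1) * poch (-x) k * hahnCoeff_lower_shift (mem_range_succ_iff.1 hk) a b M

lemma hahnCoeff_lower_param {n k : ℕ} (hk : k ≤ n) (a b M : ℝ) :
    (a + (k + 1)) * hahnCoeff n (k + 1) a b M -
        (hahnCoeff n k a b M - hahnCoeff n k a b (M - 1)) =
      (a + n) * hahnCoeff n (k + 1) (a - 1) b M := by
  obtain rfl | hk := hk.eq_or_lt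
  · simp [hahnCoeff_of_lt k.lt_succ_self, hahnCoeff_self]
  · obtain ⟨d, rfl⟩ := Nat.exists_eq_add_of_le (Nat.succ_le_of_lt hk)
    have e (M : ℝ) : hahnCoeff (k + 1 + d) k a b M = hahnCoeff (k + (d + 1)) k a b M := by
      congr 1; omega
    have hA := mul_poch_add_one (a + 1 + k) d
    rw [Nat.succ_eq_add_one, e, e, hahnCoeff_add, hahnCoeff_add, hahnCoeff_add, hahnCoeff_add]
    push_cast
    rw [show -((k : ℝ) + 1) - d = -k - (d + 1) by ring,
      show (k : ℝ) + 1 + d + a + b + 1 = k + (d + 1) + a + b + 1 by ring,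
      show (k : ℝ) + 1 + d + (a - 1) + b + 1 = k + (d + 1) + a + b by ring,
      show a - 1 + 1 + ((k : ℝ) + 1) = a + 1 + k by ring,
      show a + 1 + ((k : ℝ) + 1) = a + 1 + k + 1 by ring,
      show -M + ((k : ℝ) + 1) = -M + k + 1 by ring,
      show -(M - 1) + (k : ℝ) = -M + k + 1 by ring,
      poch_succ (-k - (d + 1)) k, poch_succ (k + (d + 1) + a + b + 1) k,
      poch_succ_left (k + (d + 1) + a + b) k, poch_succ (a + 1 + k) d, poch_succ_left (-M + k) d,
      poch_succ (-M + k + 1) d, Nat.factorial_succ]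
    generalize poch (a + 1 + k + 1) d = A at *
    push_cast
    field_simp
    linear_combination (poch (-(k : ℝ) - (d + 1)) k * poch (k + (d + 1) + a + b + 1) k *
      poch (-M + k + 1) d * (d + 1) * -(k + (d + 1) + a + b + 1 + k)) * hA

lemma hahn1_lower_param (n : ℕ) (x a b M : ℝ) :
    (x + a) * hahn1 n x a b M - x * hahn1 n (x - 1) a b (M - 1) =
      (a + n) * hahn1 n x (a - 1) b M := by
  have h0 : a * hahnCoeff n 0 a b M = (a + n) * hahnCoeff n 0 (a - 1) b M := by
    have h := mul_poch_add_one a n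
    simp only [hahnCoeff_zero_right, sub_add_cancel]
    linear_combination poch (-M) n * h
  have hx : (x + a) * hahn1 n x a b M =
      ∑ k ∈ range (n + 2), (a + k) * (hahnCoeff n k a b M * poch (-x) k) -
        ∑ k ∈ range (n + 1), hahnCoeff n k a b M * poch (-x) (k + 1) := by
    rw [sum_range_succ _ (n + 1), hahnCoeff_of_lt n.lt_succ_self, zero_mul, mul_zero, add_zero,
      hahn1_eq_sum n.lt_succ_self, mul_sum, ← sum_sub_distrib]
    exact sum_congr rfl fun k _ => by rw [poch_succ]; ring
  have hx' : x * hahn1 n (x - 1) a b (M - 1) =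
      -∑ k ∈ range (n + 1), hahnCoeff n k a b (M - 1) * poch (-x) (k + 1) := by
    rw [hahn1_eq_sum n.lt_succ_self, mul_sum, ← sum_neg_distrib]
    refine sum_congr rfl fun k _ => ?_
    rw [poch_succ_left, show -(x - 1) = -x + 1 by ring]; ring
  rw [hx, hx', sum_range_succ' _ (n + 1), hahn1_eq_sum_succ (Nat.le_succ n), mul_add, ← h0, mul_sum,
    poch_zero, Nat.cast_zero, add_zero, mul_one, sub_neg_eq_add, add_sub_right_comm,
    add_right_comm, ← sum_sub_distrib, ← sum_add_distrib]
  congr 1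
  refine sum_congr rfl fun k hk => ?_
  push_cast
  linear_combination
    poch (-x) (k + 1) * hahnCoeff_lower_param (mem_range_succ_iff.1 hk) a b M

lemma hahn1_lower (n : ℕ) (x a b M : ℝ) :
    (2 * n + a + b + 1) * (x + a) * hahn1 n x a b M =
      hahn1 (n + 1) x (a - 1) b M + (a + n) * (M + n + a + b + 1) * hahn1 n x (a - 1) b M := by
  have h1 := hahn1_lower_shift n (x - 1) a b (M - 1)
  have h2 := hahn1_lower_param n x a b M
  simp only [sub_add_cancel] at h1
  linear_combination h1 + (2 * n + a + b + 1) * h2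

lemma hahn1_reflect (n : ℕ) (x a b M : ℝ) :
    hahn1 n (-x - a - 1) a b (-M - a - b - 2) = (-1) ^ n * hahn1 n x a b M := by
  induction n generalizing x a M with
  | zero => simp [hahn1_zero]
  | succ n ih =>
    -- The reflection interchanges the two lowering relations.
    have h1 := hahn1_lower n (-x - a - 1) (a + 1) b (-M - a - b - 2)
    have h2 := hahn1_lower_shift n (x - 1) (a + 1) b (M - 1)
    have e := ih (x - 1) (a + 1) (M - 1)
    rw [show -(x - 1) - (a + 1) - 1 = -x - a - 1 by ring,
      show -(M - 1) - (a + 1) - b - 2 = -M - a - b - 2 by ring] at e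
    simp only [add_sub_cancel_right, sub_add_cancel] at h1 h2
    rw [ih] at h1
    rw [e] at h1
    rw [pow_succ]
    linear_combination -h1 - (-1) ^ n * h2

lemma hahn1_plus (n : ℕ) (x a b M : ℝ) :
    (x + a + 1) * hahn1 n (x + 1) a b (M + 1) + (M - x + b + 1) * hahn1 n x a b (M + 1) =
      (M + n + a + b + 2) * hahn1 n x a b M := by
  have h := hahn1_minus n (-x - a - 1) a b (-M - a - b - 2)
  rw [show -x - a - 1 - 1 = -(x + 1) - a - 1 by ring,
    show -M - a - b - 2 - 1 = -(M + 1) - a - b - 2 by ring] at h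
  simp only [hahn1_reflect] at h
  refine mul_left_cancel₀ (pow_ne_zero n (neg_ne_zero.2 (one_ne_zero (α := ℝ)))) ?_
  linear_combination -h

lemma hahn1_raise_shift (n : ℕ) (x a b M : ℝ) :
    (2 * n + a + b + 3) * hahn1 (n + 1) x a b M =
      (n + a + b + 2) * hahn1 (n + 1) (x - 1) (a + 1) b (M - 1) +
        (n + 1) * (n + 1 + b) * (M + n + a + b + 2) * hahn1 n (x - 1) (a + 1) b (M - 1) := by
  have h := hahn1_raise n (-x - a - 1) a b (-M - a - b - 2)
  have e (k : ℕ) := hahn1_reflect k (x - 1) (a + 1) b (M - 1)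
  rw [show -(x - 1) - (a + 1) - 1 = -x - a - 1 by ring,
    show -(M - 1) - (a + 1) - b - 2 = -M - a - b - 2 by ring] at e
  rw [hahn1_reflect, e, e, pow_succ] at h
  refine mul_left_cancel₀ (pow_ne_zero n (neg_ne_zero.2 (one_ne_zero (α := ℝ)))) ?_
  linear_combination -h

/-- The Hahn polynomial `h_n(x;a;b;M) / (b+1)_n`, normalised as in the product defining `hahnH`. -/
def hahnN (n : ℕ) (x a b M : ℝ) : ℝ := hahn1 n x a b M / poch (b + 1) n

lemma poch_mul_hahnN {n : ℕ} {b : ℝ} (hb : poch (b + 1) n ≠ 0) (x a M : ℝ) :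
    poch (b + 1) n * hahnN n x a b M = hahn1 n x a b M :=
  mul_div_cancel₀ _ hb

section Contiguous

variable {n : ℕ} {b : ℝ}

lemma hahnN_raise (hb : poch (b + 1) n ≠ 0) (x a M : ℝ) :
    (2 * n + a + b + 1) * hahnN n x a b M =
      (n + a + b + 1) * hahnN n x (a + 1) b M +
        n * (M - n + 1) * hahnN (n - 1) x (a + 1) b M := by
  cases n with
  | zero => simp [hahnN, hahn1_zero, poch_zero]
  | succ n =>
    have h := hahn1_raise n x a b M
    rw [← poch_mul_hahnN hb, ← poch_mul_hahnN hb,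
      ← poch_mul_hahnN (poch_ne_zero_of_le n.le_succ hb),
      poch_succ] at h
    rw [poch_succ] at hb
    refine mul_left_cancel₀ hb ?_
    push_cast
    linear_combination h

lemma hahnN_raise_shift (hb : poch (b + 1) n ≠ 0) (x a M : ℝ) :
    (2 * n + a + b + 1) * hahnN n x a b M =
      (n + a + b + 1) * hahnN n (x - 1) (a + 1) b (M - 1) +
        n * (M + n + a + b + 1) * hahnN (n - 1) (x - 1) (a + 1) b (M - 1) := by
  cases n with
  | zero => simp [hahnN, hahn1_zero, poch_zero]
  | succ n =>
    have h := hahn1_raise_shift n x a b M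
    rw [← poch_mul_hahnN hb, ← poch_mul_hahnN hb,
      ← poch_mul_hahnN (poch_ne_zero_of_le n.le_succ hb),
      poch_succ] at h
    rw [poch_succ] at hb
    refine mul_left_cancel₀ hb ?_
    push_cast
    linear_combination h

lemma hahnN_lower (hb : poch (b + 1) (n + 1) ≠ 0) (x a M : ℝ) :
    (2 * n + a + b + 1) * (x + a) * hahnN n x a b M =
      (n + b + 1) * hahnN (n + 1) x (a - 1) b M +
        (a + n) * (M + n + a + b + 1) * hahnN n x (a - 1) b M := by
  have h := hahn1_lower n x a b M
  have hb' := poch_ne_zero_of_le n.le_succ hb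
  rw [← poch_mul_hahnN hb, ← poch_mul_hahnN hb', ← poch_mul_hahnN hb', poch_succ] at h
  refine mul_left_cancel₀ hb' ?_
  linear_combination h

lemma hahnN_lower_shift (hb : poch (b + 1) (n + 1) ≠ 0) (x a M : ℝ) :
    (2 * n + a + b + 1) * (x + 1) * hahnN n x a b M =
      (n + b + 1) * hahnN (n + 1) (x + 1) (a - 1) b (M + 1) +
        (a + n) * (M - n + 1) * hahnN n (x + 1) (a - 1) b (M + 1) := by
  have h := hahn1_lower_shift n x a b M
  have hb' := poch_ne_zero_of_le n.le_succ hb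
  rw [← poch_mul_hahnN hb, ← poch_mul_hahnN hb', ← poch_mul_hahnN hb', poch_succ] at h
  refine mul_left_cancel₀ hb' ?_
  linear_combination h

variable (x a M : ℝ) (h0 : 2 * n + a + b ≠ 0) (h1 : 2 * n + a + b + 1 ≠ 0)
  (h2 : 2 * n + a + b + 2 ≠ 0)

include h0 h1 h2

lemma hahnN_three_term_raise (hb : poch (b + 1) n ≠ 0) :
    (n + a + b + 1) * (n + a + b + 2) / ((2 * n + a + b + 1) * (2 * n + a + b + 2)) *
        hahnN n (x - 1) (a + 2) b (M - 1) +
      n * (n + a + b + 1) * (2 * M + a + b + 2) / ((2 * n + a + b) * (2 * n + a + b + 2)) *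
        hahnN (n - 1) (x - 1) (a + 2) b (M - 1) +
      n * (n - 1) / ((2 * n + a + b) * (2 * n + a + b + 1)) *
        ((M - n + 1) * (M + n + a + b + 1)) * hahnN (n - 2) (x - 1) (a + 2) b (M - 1) =
      hahnN n x a b M := by
  have e1 := hahnN_raise hb x a M
  have e2 := hahnN_raise_shift hb x (a + 1) M
  have e3 : n * ((2 * n + a + b) * hahnN (n - 1) x (a + 1) b M) =
      n * ((n + a + b + 1) * hahnN (n - 1) (x - 1) (a + 2) b (M - 1) +
        (n - 1) * (M + n + a + b + 1) * hahnN (n - 2) (x - 1) (a + 2) b (M - 1)) := by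
    cases n with
    | zero => simp
    | succ n =>
      have h := hahnN_raise_shift (poch_ne_zero_of_le n.le_succ hb) x (a + 1) M
      rw [show a + 1 + 1 = a + 2 by ring] at h
      rw [Nat.add_sub_cancel, show n + 1 - 2 = n - 1 by omega]
      push_cast
      linear_combination (n + 1 : ℝ) * h
  rw [show a + 1 + 1 = a + 2 by ring] at e2
  generalize hz : 2 * (n : ℝ) + a + b = z at *
  field_simp
  subst hz
  linear_combination -(2 * n + a + b) * (2 * n + a + b + 2) * e1 -
    (2 * n + a + b) * (n + a + b + 1) * e2 - (2 * n + a + b + 2) * (M - n + 1) * e3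

lemma hahnN_three_term (hb : poch (b + 1) (n + 1) ≠ 0) :
    -((n + a + b + 1) * (n + b + 1) / ((2 * n + a + b + 1) * (2 * n + a + b + 2))) *
        (hahnN (n + 1) x a b M - (M - n) * hahnN n x a b M) -
      n * (n + a) / ((2 * n + a + b) * (2 * n + a + b + 1)) *
        ((M - n + 1) * (M + n + a + b + 1) * hahnN (n - 1) x a b M -
          (M + n + a + b + 1) * hahnN n x a b M) =
      (M - x) * hahnN n x a b M := by
  have e1 := hahnN_lower hb x a M
  have e2 := hahnN_raise hb x (a - 1) M
  have e3 := hahnN_raise (poch_ne_zero_of_le n.le_succ hb) x (a - 1) M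
  rw [sub_add_cancel] at e2 e3
  rw [Nat.add_sub_cancel] at e2
  push_cast at e2
  generalize hz : 2 * (n : ℝ) + a + b = z at *
  field_simp
  subst hz
  linear_combination (2 * n + a + b) * (2 * n + a + b + 2) * e1 +
    (2 * n + a + b) * (n + b + 1) * e2 + (2 * n + a + b + 2) * (a + n) * (M + n + a + b + 1) * e3

lemma hahnN_three_term_lower (hb : poch (b + 1) (n + 2) ≠ 0) :
    (n + b + 1) * (n + b + 2) / ((2 * n + a + b + 1) * (2 * n + a + b + 2)) *
        hahnN (n + 2) (x + 1) (a - 2) b (M + 1) +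
      (a + n) * (n + b + 1) * (2 * M + a + b + 2) / ((2 * n + a + b) * (2 * n + a + b + 2)) *
        hahnN (n + 1) (x + 1) (a - 2) b (M + 1) +
      (a + n) * (a + n - 1) / ((2 * n + a + b) * (2 * n + a + b + 1)) *
        ((M - n + 1) * (M + n + a + b + 1)) * hahnN n (x + 1) (a - 2) b (M + 1) =
      (x + 1) * (x + a) * hahnN n x a b M := by
  have hb' := poch_ne_zero_of_le (n + 1).le_succ hb
  have e1 := hahnN_lower hb' x a M
  have e2 := hahnN_lower_shift hb x (a - 1) M
  have e3 := hahnN_lower_shift hb' x (a - 1) M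
  rw [show a - 1 - 1 = a - 2 by ring] at e2 e3
  rw [show n + 1 + 1 = n + 2 by rfl] at e2
  push_cast at e2
  generalize hz : 2 * (n : ℝ) + a + b = z at *
  field_simp
  subst hz
  linear_combination -(2 * n + a + b) * (2 * n + a + b + 2) * (x + 1) * e1 -
    (2 * n + a + b) * (n + b + 1) * e2 - (2 * n + a + b + 2) * (a + n) * (M + n + a + b + 1) * e3

end Contiguous

/-! ### The spectral equation in `y` -/

/-- Extension of a vector to a sequence by zeros. Vectors of every length become sequences indexed
by `ℕ`, so that arguments by induction on the length need no casts between the types `Fin m`. -/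
def zeroExtend {α : Type*} [Zero α] {m : ℕ} (v : Fin m → α) (i : ℕ) : α :=
  if h : i < m then v ⟨i, h⟩ else 0

lemma zeroExtend_val {α : Type*} [Zero α] {m : ℕ} (v : Fin m → α) (i : Fin m) :
    zeroExtend v i = v i := by simp [zeroExtend]

lemma zeroExtend_of_le {α : Type*} [Zero α] {m : ℕ} (v : Fin m → α) {i : ℕ} (h : m ≤ i) :
    zeroExtend v i = 0 := by simp [zeroExtend, h]

/-- The partial sum of the first `k` terms of a sequence, in the notation `N_1^k`, `γ_1^k`,
`Y_1^k`. -/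
def partialSum {R : Type*} [AddCommMonoid R] (v : ℕ → R) (k : ℕ) : R := ∑ i ∈ range k, v i

lemma partialSum_succ {R : Type*} [AddCommMonoid R] (v : ℕ → R) (k : ℕ) :
    partialSum v (k + 1) = partialSum v k + v k := sum_range_succ _ _

lemma sum_fin_ite_lt {m k : ℕ} (f : ℕ → ℝ) (hf : ∀ i, m ≤ i → i < k → f i = 0) :
    ∑ i : Fin m, (if (i : ℕ) < k then f i else 0) = ∑ i ∈ range k, f i := by
  rw [← sum_range (fun i => if i < k then f i else 0), ← sum_filter]
  refine sum_subset (fun i hi => by simp_all) fun i hi hi' => hf i ?_ (mem_range.1 hi)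
  by_contra h
  exact hi' (by simp_all)

lemma psum_eq_partialSum {m : ℕ} (v : Fin m → ℝ) (k : ℕ) :
    psum v k = partialSum (zeroExtend v) k := by
  rw [partialSum, ← sum_fin_ite_lt _ fun i hi _ => zeroExtend_of_le v hi]
  simp only [psum, zeroExtend_val]

lemma psum_natCast {p : ℕ} (n : Fin p → ℕ) (k : ℕ) :
    psum (fun i => (n i : ℝ)) k = (partialSum (zeroExtend n) k : ℕ) := by
  rw [psum_eq_partialSum, partialSum, partialSum, Nat.cast_sum]
  exact sum_congr rfl fun i _ => by unfold zeroExtend; split <;> simp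

lemma partialSum_add_single {R : Type*} [AddCommMonoid R] (y : ℕ → R) (l k : ℕ) (t : R) :
    partialSum (y + Pi.single l t) k = partialSum y k + if l < k then t else 0 := by
  simp [partialSum, sum_add_distrib, Pi.single_apply]

section SpectralY

variable (n : ℕ → ℕ) (γ : ℕ → ℝ)

/-- The factor number `k` (counted from `0`) of the product in `hahnH`, as a function of the two
partial sums `X = Y_1^{k+1}` and `M = Y_1^{k+2}` on which it depends. -/
def hahnFactor (k : ℕ) (X M : ℝ) : ℝ :=
  hahn1 (n k) (X - partialSum n k) (2 * partialSum n k + partialSum γ (k + 1) + k) (γ (k + 1))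
    (M - partialSum n k)

/-- The product of the first `j` factors in `hahnH`. -/
def hahnProd (j : ℕ) (y : ℕ → ℝ) : ℝ :=
  ∏ k ∈ range j, hahnFactor n γ k (partialSum y (k + 1)) (partialSum y (k + 2))

/-- The eigenvalue `μ̃_j(n) = -N_1^j (N_1^j + j + γ_1 + ⋯ + γ_{j+1})`. -/
def hahnEigenvalue (j : ℕ) : ℝ :=
  -(partialSum n j * (partialSum n j + j + partialSum γ (j + 1)))

lemma hahnFactor_minus (k : ℕ) (X M : ℝ) :
    (X - partialSum n k) * hahnFactor n γ k (X - 1) (M - 1) +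
        (M - X) * hahnFactor n γ k X (M - 1) =
      (M - partialSum n (k + 1)) * hahnFactor n γ k X M := by
  have h := hahn1_minus (n k) (X - partialSum n k) (2 * partialSum n k + partialSum γ (k + 1) + k)
    (γ (k + 1)) (M - partialSum n k)
  simp only [hahnFactor, sub_right_comm _ (1 : ℝ), partialSum_succ n, Nat.cast_add]
  linear_combination h

lemma hahnFactor_plus (k : ℕ) (X M : ℝ) :
    (X + partialSum n k + partialSum γ (k + 1) + k + 1) * hahnFactor n γ k (X + 1) (M + 1) +
        (M - X + γ (k + 1) + 1) * hahnFactor n γ k X (M + 1) =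
      (M + partialSum n (k + 1) + partialSum γ (k + 2) + k + 2) * hahnFactor n γ k X M := by
  have h := hahn1_plus (n k) (X - partialSum n k) (2 * partialSum n k + partialSum γ (k + 1) + k)
    (γ (k + 1)) (M - partialSum n k)
  simp only [hahnFactor, add_sub_right_comm _ (1 : ℝ), partialSum_succ n, partialSum_succ γ (k + 1),
    Nat.cast_add]
  linear_combination h

lemma hahnFactor_eigen (k : ℕ) (X M : ℝ) :
    (X + partialSum n k + partialSum γ (k + 1) + k + 1) * (M - X) * hahnFactor n γ k (X + 1) M +
        (M - X + γ (k + 1) + 1) * (X - partialSum n k) * hahnFactor n γ k (X - 1) M =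
      (hahnEigenvalue n γ (k + 1) - hahnEigenvalue n γ k +
        (X + partialSum γ (k + 1) + k + 1) * (M - X) + (M - X + γ (k + 1) + 1) * X) *
          hahnFactor n γ k X M := by
  have h := hahn1_eigen (n k) (X - partialSum n k) (2 * partialSum n k + partialSum γ (k + 1) + k)
    (γ (k + 1)) (M - partialSum n k)
  simp only [hahnFactor, hahnEigenvalue, add_sub_right_comm _ (1 : ℝ), sub_right_comm _ (1 : ℝ),
    partialSum_succ n, partialSum_succ γ (k + 1), Nat.cast_add, Nat.cast_one]
  linear_combination h

lemma hahnProd_succ (j : ℕ) (y : ℕ → ℝ) :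
    hahnProd n γ (j + 1) y =
      hahnProd n γ j y * hahnFactor n γ j (partialSum y (j + 1)) (partialSum y (j + 2)) :=
  prod_range_succ _ _

lemma hahnProd_succ_add_single_of_le {j m : ℕ} (hm : m ≤ j) (y : ℕ → ℝ) (t : ℝ) :
    hahnProd n γ (j + 1) (y + Pi.single m t) = hahnProd n γ j (y + Pi.single m t) *
      hahnFactor n γ j (partialSum y (j + 1) + t) (partialSum y (j + 2) + t) := by
  rw [hahnProd_succ, partialSum_add_single, partialSum_add_single, if_pos (by omega),
    if_pos (by omega)]

lemma hahnProd_succ_add_single_self (j : ℕ) (y : ℕ → ℝ) (t : ℝ) :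
    hahnProd n γ (j + 1) (y + Pi.single (j + 1) t) =
      hahnProd n γ j y * hahnFactor n γ j (partialSum y (j + 1)) (partialSum y (j + 2) + t) := by
  have h : hahnProd n γ j (y + Pi.single (j + 1) t) = hahnProd n γ j y := by
    refine prod_congr rfl fun k hk => ?_
    have hk := mem_range.1 hk
    simp only [partialSum_add_single, if_neg (show ¬ j + 1 < k + 1 by omega),
      if_neg (show ¬ j + 1 < k + 2 by omega), add_zero]
  rw [hahnProd_succ, h, partialSum_add_single, partialSum_add_single, if_neg (by omega),
    if_pos (by omega), add_zero]

lemma hahnProd_succ_add_single_add_single {j l m : ℕ} (hl : l ≤ j) (hm : m ≤ j) (y : ℕ → ℝ) :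
    hahnProd n γ (j + 1) (y + Pi.single l 1 + Pi.single m (-1)) =
      hahnProd n γ j (y + Pi.single l 1 + Pi.single m (-1)) *
        hahnFactor n γ j (partialSum y (j + 1)) (partialSum y (j + 2)) := by
  simp only [hahnProd_succ_add_single_of_le n γ hm, partialSum_add_single,
    if_pos (show l < j + 1 by omega), if_pos (show l < j + 2 by omega), add_neg_cancel_right]

lemma hahnProd_minus (j : ℕ) (y : ℕ → ℝ) :
    ∑ m ∈ range (j + 1), y m * hahnProd n γ j (y + Pi.single m (-1)) =
      (partialSum y (j + 1) - partialSum n j) * hahnProd n γ j y := by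
  induction j with
  | zero => simp [hahnProd, partialSum]
  | succ j ih =>
    have h := hahnFactor_minus n γ j (partialSum y (j + 1)) (partialSum y (j + 2))
    have hsum : ∑ m ∈ range (j + 1), y m * hahnProd n γ (j + 1) (y + Pi.single m (-1)) =
        (∑ m ∈ range (j + 1), y m * hahnProd n γ j (y + Pi.single m (-1))) *
          hahnFactor n γ j (partialSum y (j + 1) - 1) (partialSum y (j + 2) - 1) := by
      rw [sum_mul]
      refine sum_congr rfl fun m hm => ?_
      rw [hahnProd_succ_add_single_of_le n γ (mem_range_succ_iff.1 hm), ← mul_assoc]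
      rfl
    rw [sum_range_succ, hsum, ih, hahnProd_succ_add_single_self, hahnProd_succ,
      ← sub_eq_add_neg (partialSum y (j + 2)),
      eq_sub_of_add_eq' (partialSum_succ y (j + 1)).symm]
    linear_combination hahnProd n γ j y * h

lemma hahnProd_plus (j : ℕ) (y : ℕ → ℝ) :
    ∑ l ∈ range (j + 1), (y l + γ l + 1) * hahnProd n γ j (y + Pi.single l 1) =
      (partialSum y (j + 1) + partialSum n j + partialSum γ (j + 1) + j + 1) *
        hahnProd n γ j y := by
  induction j with
  | zero => simp [hahnProd, partialSum]
  | succ j ih =>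
    have h := hahnFactor_plus n γ j (partialSum y (j + 1)) (partialSum y (j + 2))
    have hsum : ∑ l ∈ range (j + 1), (y l + γ l + 1) * hahnProd n γ (j + 1) (y + Pi.single l 1) =
        (∑ l ∈ range (j + 1), (y l + γ l + 1) * hahnProd n γ j (y + Pi.single l 1)) *
          hahnFactor n γ j (partialSum y (j + 1) + 1) (partialSum y (j + 2) + 1) := by
      rw [sum_mul]
      refine sum_congr rfl fun l hl => ?_
      rw [hahnProd_succ_add_single_of_le n γ (mem_range_succ_iff.1 hl), ← mul_assoc]
    rw [sum_range_succ, hsum, ih, hahnProd_succ_add_single_self, hahnProd_succ,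
      eq_sub_of_add_eq' (partialSum_succ y (j + 1)).symm]
    push_cast
    linear_combination hahnProd n γ j y * h

lemma sum_add_add_one (j : ℕ) (y : ℕ → ℝ) :
    ∑ l ∈ range (j + 1), (y l + γ l + 1) =
      partialSum y (j + 1) + partialSum γ (j + 1) + j + 1 := by
  simp [partialSum, sum_add_distrib, add_assoc]

lemma sum_hahnProd_succ_sub_last (j : ℕ) (y : ℕ → ℝ) :
    ∑ l ∈ range (j + 1), (y l + γ l + 1) * y (j + 1) *
        hahnProd n γ (j + 1) (y + Pi.single l 1 + Pi.single (j + 1) (-1)) =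
      y (j + 1) * (∑ l ∈ range (j + 1), (y l + γ l + 1) * hahnProd n γ j (y + Pi.single l 1)) *
        hahnFactor n γ j (partialSum y (j + 1) + 1) (partialSum y (j + 2)) := by
  rw [mul_sum, sum_mul]
  refine sum_congr rfl fun l hl => ?_
  rw [hahnProd_succ_add_single_self, partialSum_add_single, partialSum_add_single,
    if_pos (mem_range.1 hl), if_pos (by have := mem_range.1 hl; omega), add_neg_cancel_right]
  ring

lemma sum_hahnProd_succ_add_last (j : ℕ) (y : ℕ → ℝ) :
    ∑ m ∈ range (j + 1), (y (j + 1) + γ (j + 1) + 1) * y m *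
        hahnProd n γ (j + 1) (y + Pi.single (j + 1) 1 + Pi.single m (-1)) =
      (y (j + 1) + γ (j + 1) + 1) *
        (∑ m ∈ range (j + 1), y m * hahnProd n γ j (y + Pi.single m (-1))) *
          hahnFactor n γ j (partialSum y (j + 1) - 1) (partialSum y (j + 2)) := by
  rw [mul_sum, sum_mul]
  refine sum_congr rfl fun m hm => ?_
  rw [add_right_comm y, hahnProd_succ_add_single_self, partialSum_add_single,
    partialSum_add_single, if_pos (mem_range.1 hm),
    if_pos (by have := mem_range.1 hm; omega), neg_add_cancel_right, ← sub_eq_add_neg]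
  ring

lemma hahnProd_sum_sum_self (j : ℕ) (y : ℕ → ℝ) :
    ∑ l ∈ range (j + 1), ∑ m ∈ range (j + 1), (y l + γ l + 1) * y m *
        hahnProd n γ j (y + Pi.single l 1 + Pi.single m (-1)) =
      (hahnEigenvalue n γ j + (partialSum y (j + 1) + partialSum γ (j + 1) + j + 1) *
        partialSum y (j + 1)) * hahnProd n γ j y := by
  induction j with
  | zero => simp [hahnProd, partialSum, hahnEigenvalue]
  | succ j ih =>
    set X := partialSum y (j + 1)
    set M := partialSum y (j + 2)
    have hcorner : y + Pi.single (j + 1) 1 + Pi.single (j + 1) (-1) = y := by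
      rw [add_assoc, ← Pi.single_add]; simp
    have hinner : ∑ l ∈ range (j + 1), ∑ m ∈ range (j + 1), (y l + γ l + 1) * y m *
          hahnProd n γ (j + 1) (y + Pi.single l 1 + Pi.single m (-1)) =
        (∑ l ∈ range (j + 1), ∑ m ∈ range (j + 1), (y l + γ l + 1) * y m *
          hahnProd n γ j (y + Pi.single l 1 + Pi.single m (-1))) * hahnFactor n γ j X M := by
      simp only [sum_mul]
      refine sum_congr rfl fun l hl => sum_congr rfl fun m hm => ?_
      rw [hahnProd_succ_add_single_add_single n γ (mem_range_succ_iff.1 hl)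
        (mem_range_succ_iff.1 hm), mul_assoc _ (hahnProd ..)]
    have h := hahnFactor_eigen n γ j X M
    simp only [sum_range_succ _ (j + 1), sum_add_distrib]
    rw [hcorner, hinner, sum_hahnProd_succ_sub_last, sum_hahnProd_succ_add_last, ih,
      hahnProd_minus, hahnProd_plus, hahnProd_succ, partialSum_succ γ (j + 1),
      eq_sub_of_add_eq' (partialSum_succ y (j + 1)).symm]
    push_cast
    linear_combination hahnProd n γ j y * h

lemma hahnProd_sum_sum {j J : ℕ} (hj : j ≤ J) (y : ℕ → ℝ) :
    ∑ l ∈ range (j + 1), ∑ m ∈ range (j + 1), (y l + γ l + 1) * y m *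
        hahnProd n γ J (y + Pi.single l 1 + Pi.single m (-1)) =
      (hahnEigenvalue n γ j + (partialSum y (j + 1) + partialSum γ (j + 1) + j + 1) *
        partialSum y (j + 1)) * hahnProd n γ J y := by
  induction J, hj using Nat.le_induction with
  | base => exact hahnProd_sum_sum_self n γ j y
  | succ J hj ih =>
    rw [hahnProd_succ, ← mul_assoc, ← ih, sum_mul]
    refine sum_congr rfl fun l hl => ?_
    rw [sum_mul]
    refine sum_congr rfl fun m hm => ?_
    rw [hahnProd_succ_add_single_add_single n γ ((mem_range_succ_iff.1 hl).trans hj)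
      ((mem_range_succ_iff.1 hm).trans hj), mul_assoc _ (hahnProd ..)]

lemma hahnProd_eigen {j J : ℕ} (hj : j ≤ J) (y : ℕ → ℝ) :
    ∑ l ∈ range (j + 1), ∑ m ∈ range (j + 1), (y l + γ l + 1) * y m *
        (hahnProd n γ J (y + Pi.single l 1 + Pi.single m (-1)) - hahnProd n γ J y) =
      hahnEigenvalue n γ j * hahnProd n γ J y := by
  simp only [mul_sub, sum_sub_distrib, hahnProd_sum_sum n γ hj, ← sum_mul, ← mul_sum,
    sum_add_add_one]
  rw [partialSum]
  ring

end SpectralY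

/-- The factor of `H_p` which does not depend on `y`. -/
def hahnPrefactor {p : ℕ} (n : Fin p → ℕ) (γ : Fin (p + 1) → ℝ) (N : ℝ) : ℝ :=
  (-1) ^ (∑ i, n i) / (poch (-N) (∑ i, n i) * ∏ k : Fin p, poch (γ k.succ + 1) (n k))

lemma hahnH_eq_mul_hahnProd {p : ℕ} (n : Fin p → ℕ) (y : Fin p → ℝ) (γ : Fin (p + 1) → ℝ) (N : ℝ) :
    hahnH n y γ N = hahnPrefactor n γ N *
      hahnProd (zeroExtend n) (zeroExtend γ) p (zeroExtend (compl y N)) := by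
  rw [hahnH, hahnPrefactor, hahnProd, prod_range]
  congr 1
  refine prod_congr rfl fun k _ => ?_
  rw [hahnFactor, psum_natCast, zeroExtend_val, psum_eq_partialSum, psum_eq_partialSum,
    psum_eq_partialSum]
  congr 1
  exact (zeroExtend_val γ k.succ).symm

lemma sum_unitVec {p : ℕ} (l : Fin (p + 1)) :
    ∑ i : Fin p, unitVec l i = if l = Fin.last p then 0 else 1 := by
  induction l using Fin.lastCases <;> simp [unitVec, Fin.castSucc_ne_last]

lemma zeroExtend_compl_shift {p : ℕ} (y : Fin p → ℝ) (N : ℝ) (l m : Fin (p + 1)) :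
    zeroExtend (compl (y + unitVec l - unitVec m) N) =
      zeroExtend (compl y N) + Pi.single (l : ℕ) 1 + Pi.single (m : ℕ) (-1) := by
  ext i
  obtain hi | hi := lt_or_ge i (p + 1)
  · obtain ⟨i, rfl⟩ : ∃ i' : Fin (p + 1), (i' : ℕ) = i := ⟨⟨i, hi⟩, rfl⟩
    simp only [Pi.add_apply, zeroExtend_val, Pi.single_apply, Fin.val_inj]
    induction i using Fin.lastCases with
    | last =>
      simp only [compl, Fin.snoc_last, Pi.add_apply, Pi.sub_apply, sum_add_distrib,
        sum_sub_distrib, sum_unitVec, eq_comm (a := Fin.last p)]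
      split_ifs <;> ring
    | cast i =>
      simp only [compl, Fin.snoc_castSucc, Pi.add_apply, Pi.sub_apply, unitVec]
      split_ifs <;> ring
  · simp [zeroExtend_of_le _ hi, show i ≠ l by omega, show i ≠ m by omega]

lemma hahnOpY_eq_sum_range {p j : ℕ} (hjp : j ≤ p) (γ : Fin (p + 1) → ℝ) (N : ℝ)
    (G : (ℕ → ℝ) → ℝ) (y : Fin p → ℝ) :
    hahnOpY j γ N (fun y' => G (zeroExtend (compl y' N))) y =
      ∑ l ∈ range (j + 1), ∑ m ∈ range (j + 1),
        (zeroExtend (compl y N) l + zeroExtend γ l + 1) * zeroExtend (compl y N) m *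
          (G (zeroExtend (compl y N) + Pi.single l 1 + Pi.single m (-1)) -
            G (zeroExtend (compl y N))) := by
  have conv (f : ℕ → ℝ) :=
    sum_fin_ite_lt (m := p + 1) (k := j + 1) f fun i hi hi' => absurd hi (by omega)
  simp only [← conv, hahnOpY]
  refine sum_congr rfl fun l _ => ?_
  split_ifs with hl
  · refine sum_congr rfl fun m _ => ?_
    by_cases hlm : l = m
    · subst hlm
      rw [add_assoc _ (Pi.single _ _), ← Pi.single_add, add_neg_cancel, Pi.single_zero, add_zero]
      simp
    · simp only [hlm, hl, zeroExtend_compl_shift, zeroExtend_val, ne_eq, not_false_eq_true,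
        true_and]
  · simp [hl]

lemma hahnOpY_hahnH {p j : ℕ} (hjp : j ≤ p) (n : Fin p → ℕ) (γ : Fin (p + 1) → ℝ) (N : ℝ)
    (y : Fin p → ℝ) :
    hahnOpY j γ N (fun y' => hahnH n y' γ N) y =
      -(psum (fun i => (n i : ℝ)) j * (psum (fun i => (n i : ℝ)) j + j + psum γ (j + 1))) *
        hahnH n y γ N := by
  simp only [hahnH_eq_mul_hahnProd]
  rw [hahnOpY_eq_sum_range hjp γ N fun z =>
    hahnPrefactor n γ N * hahnProd (zeroExtend n) (zeroExtend γ) p z]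
  simp only [← mul_sub, mul_left_comm _ (hahnPrefactor n γ N), ← mul_sum]
  rw [hahnProd_eigen _ _ hjp, hahnEigenvalue, psum_natCast, psum_eq_partialSum]

/-! ### A recursion for the Racah operators -/

/-- A product over the support of `ν` of weights `f` at the first element, `g` at the pairs of
consecutive elements, `1 / d` at all elements, and `l` at the last element: the shape of `A_ν`. -/
def chainWeight (f : ℕ → SignType → ℝ) (g : ℕ → SignType → ℕ → SignType → ℝ)
    (d l : ℕ → SignType → ℝ) {r : ℕ} (ν : Fin r → SignType) : ℝ :=
  (∏ i : Fin r, if ν i ≠ 0 ∧ ∀ k, ν k ≠ 0 → i ≤ k then f i (ν i) else 1) *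
  (∏ i : Fin r, ∏ k : Fin r,
    if ν i ≠ 0 ∧ ν k ≠ 0 ∧ i < k ∧ ∀ m, ν m ≠ 0 → ¬(i < m ∧ m < k) then
      g i (ν i) k (ν k) else 1) /
  (∏ i : Fin r, if ν i ≠ 0 then d i (ν i) else 1) *
  (∏ i : Fin r, if ν i ≠ 0 ∧ ∀ k, ν k ≠ 0 → k ≤ i then l i (ν i) else 1)

/-- For the translation `E` by `v`, the operator `E - 1` if `s = 1` and `E⁻¹ - 1` if `s = -1`. Thus
the sign `(-1)^{|ν⁻|}` of the Racah operator is absorbed into the differences. -/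
def stepDiff {p : ℕ} (v : Fin p → ℤ) (s : SignType) (F : (Fin p → ℤ) → ℝ) : (Fin p → ℤ) → ℝ :=
  (if s = -1 then (-1 : ℝ) else 1) • diffOp v s F

lemma stepDiff_one {p : ℕ} (v : Fin p → ℤ) (F : (Fin p → ℤ) → ℝ) :
    stepDiff v 1 F = (fun n => F (n + v)) - F := by
  ext n
  simp [stepDiff, diffOp, translate, LinearMap.funLeft]

lemma stepDiff_neg_one {p : ℕ} (v : Fin p → ℤ) (F : (Fin p → ℤ) → ℝ) :
    stepDiff v (-1) F = (fun n => F (n - v)) - F := by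
  ext n
  simp [stepDiff, diffOp, translate, LinearMap.funLeft, sub_eq_add_neg]

/-- The term of index `ν` of a Racah operator, with coefficient `chainWeight f g d l ν`. -/
def chainTerm {p : ℕ} (v : ℕ → Fin p → ℤ) (f : ℕ → SignType → ℝ)
    (g : ℕ → SignType → ℕ → SignType → ℝ) (d l : ℕ → SignType → ℝ) (n : Fin p → ℤ) {r : ℕ}
    (ν : Fin r → SignType) (F : (Fin p → ℤ) → ℝ) : ℝ :=
  (-1) ^ #{i | ν i = -1} * chainWeight f g d l ν *
    (List.ofFn fun i : Fin r => diffOp (v i) (ν i)).prod F n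

/-- The sum of `chainTerm v f g d l n ν F` over all `ν : Fin r → SignType`, `ν ≠ 0`, computed by
splitting off the last entry of `ν`. -/
def chainOp {p : ℕ} (v : ℕ → Fin p → ℤ) (f : ℕ → SignType → ℝ)
    (g : ℕ → SignType → ℕ → SignType → ℝ) (d : ℕ → SignType → ℝ) (n : Fin p → ℤ) :
    (r : ℕ) → (l : ℕ → SignType → ℝ) → ((Fin p → ℤ) → ℝ) → ℝ
  | 0, _, _ => 0
  | r + 1, l, F => chainOp v f g d n r l F +
      (l r 1 / d r 1 * (f r 1 * stepDiff (v r) 1 F n +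
        chainOp v f g d n r (fun i s => g i s r 1) (stepDiff (v r) 1 F)) +
      l r (-1) / d r (-1) * (f r (-1) * stepDiff (v r) (-1) F n +
        chainOp v f g d n r (fun i s => g i s r (-1)) (stepDiff (v r) (-1) F)))

lemma neg_one_pow_card_snoc {r : ℕ} (ν : Fin r → SignType) (ε : SignType) :
    (-1 : ℝ) ^ #{i | (Fin.snoc ν ε : Fin (r + 1) → SignType) i = -1} =
      (-1) ^ #{i | ν i = -1} * if ε = -1 then (-1 : ℝ) else 1 := by
  have h {m : ℕ} (μ : Fin m → SignType) :
      (-1 : ℝ) ^ #{i | μ i = -1} = ∏ i, if μ i = -1 then (-1 : ℝ) else 1 := by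
    rw [prod_ite]; simp
  simp [h, Fin.prod_univ_castSucc]

lemma sum_signType {M : Type*} [AddCommMonoid M] (G : SignType → M) :
    ∑ s, G s = G 0 + (G (-1) + G 1) := by
  rw [SignType.univ_eq, sum_insert (by decide), sum_insert (by decide), sum_singleton]

lemma sum_ne_zero_fin_succ {M : Type*} [AddCommGroup M] {r : ℕ}
    (G : (Fin (r + 1) → SignType) → M) :
    ∑ ν with ν ≠ 0, G ν = ∑ ν with ν ≠ 0, G (Fin.snoc ν 0) +
      ((G (Fin.snoc 0 1) + ∑ ν with ν ≠ 0, G (Fin.snoc ν 1)) +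
        (G (Fin.snoc 0 (-1)) + ∑ ν with ν ≠ 0, G (Fin.snoc ν (-1)))) := by
  have hzero : (Fin.snoc (0 : Fin r → SignType) 0 : Fin (r + 1) → SignType) = 0 := by
    ext i; induction i using Fin.lastCases <;> simp
  have hsum : ∑ ν, G ν = ∑ s, ∑ ν : Fin r → SignType, G (Fin.snoc ν s) := by
    rw [← (Fin.snocEquiv fun _ => SignType).sum_comp, Fintype.sum_prod_type]; rfl
  simp only [filter_ne', sum_erase_eq_sub (mem_univ _), hsum, sum_signType, hzero]
  abel

section Chain

variable {p : ℕ} (v : ℕ → Fin p → ℤ) (f : ℕ → SignType → ℝ)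
  (g : ℕ → SignType → ℕ → SignType → ℝ) (d l : ℕ → SignType → ℝ) (n : Fin p → ℤ)

lemma chainWeight_snoc_zero {r : ℕ} (ν : Fin r → SignType) :
    chainWeight f g d l (Fin.snoc ν 0 : Fin (r + 1) → SignType) = chainWeight f g d l ν := by
  simp [chainWeight, Fin.prod_univ_castSucc, Fin.forall_fin_succ']

lemma chainWeight_zero_snoc (r : ℕ) {ε : SignType} (hε : ε ≠ 0) :
    chainWeight f g d l (Fin.snoc (0 : Fin r → SignType) ε : Fin (r + 1) → SignType) =
      l r ε / d r ε * f r ε := by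
  simp [chainWeight, Fin.prod_univ_castSucc, Fin.forall_fin_succ', hε]
  ring

lemma chainWeight_snoc {r : ℕ} {ν : Fin r → SignType} (hν : ν ≠ 0) {ε : SignType} (hε : ε ≠ 0) :
    chainWeight f g d l (Fin.snoc ν ε : Fin (r + 1) → SignType) =
      l r ε / d r ε * chainWeight f g d (fun i s => g i s r ε) ν := by
  have hν' : ¬ ∀ k, ν k = 0 := fun h => hν (funext h)
  have hite (c : Prop) [Decidable c] (A B : ℝ) :
      (if c then A * B else A) = A * if c then B else 1 := by
    rw [mul_ite, mul_one]
  simp [chainWeight, Fin.prod_univ_castSucc, Fin.forall_fin_succ', hε, hν', Fin.le_last,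
    -not_forall, Fin.castSucc_lt_last, (Fin.castSucc_lt_last _).not_ge,
    (Fin.castSucc_lt_last _).not_gt]
  simp only [hite, prod_mul_distrib]
  ring_nf

lemma prod_diffOp_snoc {r : ℕ} (ν : Fin r → SignType) (ε : SignType) (F : (Fin p → ℤ) → ℝ) :
    (List.ofFn fun i : Fin (r + 1) =>
        diffOp (v i) ((Fin.snoc ν ε : Fin (r + 1) → SignType) i)).prod F =
      (List.ofFn fun i : Fin r => diffOp (v i) (ν i)).prod (diffOp (v r) ε F) := by
  rw [List.ofFn_succ_last, List.prod_append]
  simp [Module.End.mul_apply]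

lemma chainTerm_snoc_zero {r : ℕ} (ν : Fin r → SignType) (F : (Fin p → ℤ) → ℝ) :
    chainTerm v f g d l n (Fin.snoc ν 0 : Fin (r + 1) → SignType) F =
      chainTerm v f g d l n ν F := by
  rw [chainTerm, neg_one_pow_card_snoc, chainWeight_snoc_zero, prod_diffOp_snoc]
  simp [chainTerm, diffOp]

lemma chainTerm_zero_snoc (r : ℕ) {ε : SignType} (hε : ε ≠ 0) (F : (Fin p → ℤ) → ℝ) :
    chainTerm v f g d l n (Fin.snoc (0 : Fin r → SignType) ε : Fin (r + 1) → SignType) F =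
      l r ε / d r ε * (f r ε * stepDiff (v r) ε F n) := by
  have hprod : (List.ofFn fun i : Fin r => diffOp (v i) ((0 : Fin r → SignType) i)).prod = 1 := by
    simp [diffOp]
  have hsign : (-1 : ℝ) ^ #{i | (0 : Fin r → SignType) i = -1} = 1 := by simp
  rw [chainTerm, neg_one_pow_card_snoc, chainWeight_zero_snoc _ _ _ _ _ hε, prod_diffOp_snoc,
    hprod, hsign, Module.End.one_apply, stepDiff, Pi.smul_apply, smul_eq_mul]
  ring

lemma chainTerm_snoc {r : ℕ} {ν : Fin r → SignType} (hν : ν ≠ 0) {ε : SignType} (hε : ε ≠ 0)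
    (F : (Fin p → ℤ) → ℝ) :
    chainTerm v f g d l n (Fin.snoc ν ε : Fin (r + 1) → SignType) F =
      l r ε / d r ε * chainTerm v f g d (fun i s => g i s r ε) n ν (stepDiff (v r) ε F) := by
  rw [chainTerm, chainTerm, neg_one_pow_card_snoc, chainWeight_snoc _ _ _ _ hν hε,
    prod_diffOp_snoc, stepDiff, map_smul, Pi.smul_apply, smul_eq_mul]
  ring

lemma sum_chainTerm (r : ℕ) (F : (Fin p → ℤ) → ℝ) :
    ∑ ν : Fin r → SignType with ν ≠ 0, chainTerm v f g d l n ν F = chainOp v f g d n r l F := by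
  induction r generalizing l F with
  | zero => exact sum_eq_zero fun ν hν => absurd (Subsingleton.elim ν 0) (mem_filter.1 hν).2
  | succ r ih =>
    have hsnoc (ε : SignType) (hε : ε ≠ 0) :
        ∑ ν : Fin r → SignType with ν ≠ 0, chainTerm v f g d l n (Fin.snoc ν ε) F =
          l r ε / d r ε * chainOp v f g d n r (fun i s => g i s r ε) (stepDiff (v r) ε F) := by
      rw [← ih, mul_sum]
      exact sum_congr rfl fun ν hν => chainTerm_snoc v f g d l n (mem_filter.1 hν).2 hε F
    rw [sum_ne_zero_fin_succ, hsnoc 1 (by decide), hsnoc (-1) (by decide), chainOp,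
      chainTerm_zero_snoc _ _ _ _ _ _ _ (by decide), chainTerm_zero_snoc _ _ _ _ _ _ _ (by decide)]
    simp only [chainTerm_snoc_zero, ih, mul_add]

lemma chainOp_add_mul_first (f₁ f₂ : ℕ → SignType → ℝ) (t : ℝ) (r : ℕ) (F : (Fin p → ℤ) → ℝ) :
    chainOp v (fun i s => f₁ i s + t * f₂ i s) g d n r l F =
      chainOp v f₁ g d n r l F + t * chainOp v f₂ g d n r l F := by
  induction r generalizing l F with
  | zero => simp [chainOp]
  | succ r ih => simp only [chainOp, ih]; ring

lemma chainOp_linear_last (r : ℕ) (l₀ l₁ l₂ : ℕ → SignType → ℝ) (c₀ c₁ c₂ : ℝ)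
    (F : (Fin p → ℤ) → ℝ) :
    chainOp v f g d n r (fun i s => c₀ * l₀ i s + c₁ * l₁ i s + c₂ * l₂ i s) F =
      c₀ * chainOp v f g d n r l₀ F + c₁ * chainOp v f g d n r l₁ F +
        c₂ * chainOp v f g d n r l₂ F := by
  induction r with
  | zero => simp [chainOp]
  | succ r ih => simp only [chainOp, ih]; ring

lemma chainOp_sub (r : ℕ) (F G : (Fin p → ℤ) → ℝ) :
    chainOp v f g d n r l (F - G) = chainOp v f g d n r l F - chainOp v f g d n r l G := by
  simp only [← sum_chainTerm, chainTerm, map_sub, Pi.sub_apply, mul_sub, sum_sub_distrib]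

end Chain

lemma chainWeight_congr {f f' : ℕ → SignType → ℝ} {g g' : ℕ → SignType → ℕ → SignType → ℝ}
    {d d' l l' : ℕ → SignType → ℝ} {r : ℕ} (ν : Fin r → SignType)
    (hf : ∀ i < r, ∀ s, f i s = f' i s)
    (hg : ∀ i < r, ∀ s, ∀ k < r, ∀ t, g i s k t = g' i s k t)
    (hd : ∀ i < r, ∀ s, d i s = d' i s) (hl : ∀ i < r, ∀ s, l i s = l' i s) :
    chainWeight f g d l ν = chainWeight f' g' d' l' ν := by
  simp only [chainWeight, hf _ (Fin.is_lt _), hg _ (Fin.is_lt _) _ _ (Fin.is_lt _),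
    hd _ (Fin.is_lt _), hl _ (Fin.is_lt _)]

/-- The Racah variable `x_{i+1}`, or its image under the involution if `s = -1`. -/
def racahVar (β x : ℕ → ℝ) (i : ℕ) (s : SignType) : ℝ :=
  if s = -1 then -x (i + 1) - β (i + 1) else x (i + 1)

lemma racahA_eq_chainWeight (j : ℕ) (β x : ℕ → ℝ) (ν : Fin j → SignType) :
    racahA j β x ν = chainWeight
      (fun i s => (racahVar β x i s + β (i + 1) - β 0) * (racahVar β x i s + β (i + 1)))
      (fun i s k t => (racahVar β x k t + racahVar β x i s + β (k + 1)) *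
        (racahVar β x k t + racahVar β x i s + β (k + 1) + 1))
      (fun i s => (2 * racahVar β x i s + β (i + 1)) * (2 * racahVar β x i s + β (i + 1) + 1))
      (fun i s => (racahVar β x i s + β (j + 1) + x (j + 1)) * (x (j + 1) - racahVar β x i s))
      ν := by
  simp only [racahA, chainWeight, racahVar, prod_filter, prod_product, mem_filter, mem_univ,
    true_and]
  congr 1
  · congr 2
    · exact prod_congr rfl fun i _ => by by_cases h : ν i ≠ 0 <;> simp [h]
    · refine prod_congr rfl fun i _ => ?_
      by_cases h : ν i ≠ 0
      · rw [if_pos h]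
        exact prod_congr rfl fun k _ => by by_cases h' : ν k ≠ 0 <;> simp [h, h']
      · simp [h]
  · exact prod_congr rfl fun i _ => by by_cases h : ν i ≠ 0 <;> simp [h]

/-! ### The operators in `n` -/

/-- The value `T i` if `s ≠ -1`, and its image `-T i - g i` under the involution if `s = -1`. Up to
the translation by `g i + N`, these are the Racah variables after the substitution `𝔟`, with
`T i = N_1^{p-i}` and `g i = γ_1^{p-i+1} + p - i`. -/
def levelVal (T g : ℕ → ℝ) (i : ℕ) (s : SignType) : ℝ := if s = -1 then -T i - g i else T i

/-- The weights of pairs of consecutive indices, as a function of the value `z` at the second. -/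
def levelPair (T g : ℕ → ℝ) (z : ℝ) (i : ℕ) (s : SignType) : ℝ :=
  (z + levelVal T g i s + g i) * (z + levelVal T g i s + g i + 1)

/-- The denominators attached to the single indices. -/
def levelDen (T g : ℕ → ℝ) (i : ℕ) (s : SignType) : ℝ :=
  (2 * levelVal T g i s + g i) * (2 * levelVal T g i s + g i + 1)

/-- The weights of the last index in an operator in the first `r` variables. -/
def levelEnd (T g : ℕ → ℝ) (r : ℕ) (i : ℕ) (s : SignType) : ℝ :=
  (levelVal T g i s + g i + T r) * (T r + g r - levelVal T g i s - g i)

/-- The operator `𝔏̃^n_r` in the notation of `levelVal`, with arbitrary weights `l` of the last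
index (those of `𝔏̃^n_r` itself are `levelEnd T g r`). -/
def levelOp {p : ℕ} (v : ℕ → Fin p → ℤ) (T g : ℕ → ℝ) (N : ℝ) (n : Fin p → ℤ) (r : ℕ)
    (l : ℕ → SignType → ℝ) (F : (Fin p → ℤ) → ℝ) : ℝ :=
  chainOp v (fun i s => N - levelVal T g i s) (fun i s k t => levelPair T g (levelVal T g k t) i s)
    (levelDen T g) n r l F

/-- The partial sum `N_1^{p-i}`. -/
def levelSum {p : ℕ} (n : Fin p → ℤ) (i : ℕ) : ℝ := psum (fun k => (n k : ℝ)) (p - i)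

/-- The parameter `γ_1^{p-i+1} + p - i`. -/
def levelParam {p : ℕ} (γ : Fin (p + 1) → ℝ) (i : ℕ) : ℝ := psum γ (p - i + 1) + (p - i : ℕ)

lemma levelVal_one (T g : ℕ → ℝ) (i : ℕ) : levelVal T g i 1 = T i := if_neg (by decide)

lemma levelVal_neg_one (T g : ℕ → ℝ) (i : ℕ) : levelVal T g i (-1) = -T i - g i := if_pos rfl

section DualRacah

variable {p : ℕ} (γ : Fin (p + 1) → ℝ) (N : ℝ) (n : Fin p → ℤ) (β₀ : ℝ)

lemma hahnParam_zero : hahnParam γ β₀ 0 = β₀ := by simp [hahnParam, psum]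

lemma dualVar_hahnParam {i : ℕ} (hi : i < p) :
    dualVar (hahnParam γ β₀) N n (i + 1) = levelSum n i + levelParam γ i + N := by
  rw [dualVar, if_pos (Nat.succ_le_of_lt hi), hahnParam_zero, levelSum, levelParam, hahnParam,
    show p + 1 - (i + 1) = p - i by omega, show p + 2 - (i + 1) = p - i + 1 by omega]
  push_cast
  ring

lemma dualParam_hahnParam_zero : dualParam p (hahnParam γ β₀) N 0 = β₀ := by
  rw [dualParam, if_pos rfl, hahnParam_zero]

lemma dualParam_hahnParam {i : ℕ} (hi : i ≤ p) :
    dualParam p (hahnParam γ β₀) N (i + 1) = -levelParam γ i - 2 * N := by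
  rw [dualParam, if_neg i.succ_ne_zero, hahnParam_zero, levelParam, hahnParam,
    show p + 2 - (i + 1) = p - i + 1 by omega]
  push_cast
  ring

lemma racahVar_hahnParam {i : ℕ} (hi : i < p) (s : SignType) :
    racahVar (dualParam p (hahnParam γ β₀) N) (dualVar (hahnParam γ β₀) N n) i s =
      levelVal (levelSum n) (levelParam γ) i s + levelParam γ i + N := by
  rw [racahVar, dualVar_hahnParam γ N n β₀ hi, dualParam_hahnParam γ N β₀ hi.le, levelVal]
  split_ifs <;> ring

lemma racahEnd_hahnParam {j : ℕ} (hjp : j ≤ p) (z : ℝ) :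
    (z + dualParam p (hahnParam γ β₀) N (j + 1) + dualVar (hahnParam γ β₀) N n (j + 1)) *
        (dualVar (hahnParam γ β₀) N n (j + 1) - z) =
      (z - N + levelSum n j) * (levelSum n j + levelParam γ j + N - z) := by
  rw [dualParam_hahnParam γ N β₀ hjp]
  obtain hj | rfl := hjp.lt_or_eq
  · rw [dualVar_hahnParam γ N n β₀ hj]; ring
  · have hsum : levelSum n j = 0 := by simp [levelSum, psum]
    rw [dualVar, if_neg (by omega), hsum]; ring

lemma racahA_hahnParam {j : ℕ} (hjp : j ≤ p) (ν : Fin j → SignType) :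
    racahA j (dualParam p (hahnParam γ β₀) N) (dualVar (hahnParam γ β₀) N n) ν =
      chainWeight
        (fun i s => (N - levelVal (levelSum n) (levelParam γ) i s) ^ 2 +
          β₀ * (N - levelVal (levelSum n) (levelParam γ) i s))
        (fun i s k t => levelPair (levelSum n) (levelParam γ)
          (levelVal (levelSum n) (levelParam γ) k t) i s)
        (levelDen (levelSum n) (levelParam γ)) (levelEnd (levelSum n) (levelParam γ) j) ν := by
  rw [racahA_eq_chainWeight]
  refine chainWeight_congr ν (fun i hi s => ?_) (fun i hi s k hk t => ?_) (fun i hi s => ?_)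
    (fun i hi s => ?_)
  · rw [racahVar_hahnParam γ N n β₀ (by omega), dualParam_hahnParam γ N β₀ (by omega),
      dualParam_hahnParam_zero]
    ring
  · rw [racahVar_hahnParam γ N n β₀ (by omega), racahVar_hahnParam γ N n β₀ (by omega),
      dualParam_hahnParam γ N β₀ (by omega), levelPair]
    ring
  · rw [racahVar_hahnParam γ N n β₀ (by omega), dualParam_hahnParam γ N β₀ (by omega), levelDen]
    ring
  · rw [racahEnd_hahnParam γ N n β₀ hjp, racahVar_hahnParam γ N n β₀ (by omega), levelEnd]
    ring

variable (F : (Fin p → ℤ) → ℝ)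

-- Only the weight `(x_{i₁} + β_{i₁} - β₀) (x_{i₁} + β_{i₁})` of the first index involves `β₀`.
lemma exists_racahDualOp_eq_add_mul {j : ℕ} (hjp : j ≤ p) :
    ∃ A : ℝ, ∀ β₀, racahDualOp j (hahnParam γ β₀) N F n =
      A + β₀ * levelOp (fun i => dualShift p (i + 1)) (levelSum n) (levelParam γ) N n j
        (levelEnd (levelSum n) (levelParam γ) j) F := by
  refine ⟨chainOp (fun i => dualShift p (i + 1))
    (fun i s => (N - levelVal (levelSum n) (levelParam γ) i s) ^ 2)
    (fun i s k t =>
      levelPair (levelSum n) (levelParam γ) (levelVal (levelSum n) (levelParam γ) k t) i s)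
    (levelDen (levelSum n) (levelParam γ)) n j (levelEnd (levelSum n) (levelParam γ) j) F,
    fun β₀ => ?_⟩
  rw [levelOp, ← chainOp_add_mul_first, ← sum_chainTerm, racahDualOp]
  exact sum_congr rfl fun ν _ => by rw [racahA_hahnParam γ N n β₀ hjp, chainTerm]

lemma tendsto_racahDualOp {j : ℕ} (hjp : j ≤ p) :
    Tendsto (fun β₀ : ℝ => racahDualOp j (hahnParam γ β₀) N F n / β₀) atTop
      (𝓝 (levelOp (fun i => dualShift p (i + 1)) (levelSum n) (levelParam γ) N n j
        (levelEnd (levelSum n) (levelParam γ) j) F)) := by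
  obtain ⟨A, hA⟩ := exists_racahDualOp_eq_add_mul γ N n F hjp
  have hlim := (tendsto_inv_atTop_zero.const_mul A).add_const
    (levelOp (fun i => dualShift p (i + 1)) (levelSum n) (levelParam γ) N n j
      (levelEnd (levelSum n) (levelParam γ) j) F)
  rw [mul_zero, zero_add] at hlim
  refine hlim.congr' ?_
  filter_upwards [eventually_ne_atTop 0] with β₀ hβ₀
  rw [hA]
  field_simp

lemma hahnOpN_eq_levelOp {j : ℕ} (hjp : j ≤ p) :
    hahnOpN j γ N F n = levelOp (fun i => dualShift p (i + 1)) (levelSum n) (levelParam γ) N n j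
      (levelEnd (levelSum n) (levelParam γ) j) F :=
  (tendsto_racahDualOp γ N n F hjp).limUnder_eq

end DualRacah

section Level

variable {p : ℕ} (v : ℕ → Fin p → ℤ) (T g : ℕ → ℝ) (N : ℝ) (n : Fin p → ℤ)

/-- The part of a Racah operator to the left of an index at which the variable takes the value
`z`. -/
def levelTail (r : ℕ) (z : ℝ) (F : (Fin p → ℤ) → ℝ) : ℝ :=
  (N - z) * F n + levelOp v T g N n r (levelPair T g z) F

lemma levelTail_sub (r : ℕ) (z : ℝ) (F G : (Fin p → ℤ) → ℝ) :
    levelTail v T g N n r z (F - G) = levelTail v T g N n r z F - levelTail v T g N n r z G := by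
  simp only [levelTail, levelOp, chainOp_sub, Pi.sub_apply]
  ring

lemma levelOp_succ (r : ℕ) (l : ℕ → SignType → ℝ) (F : (Fin p → ℤ) → ℝ) :
    levelOp v T g N n (r + 1) l F = levelOp v T g N n r l F +
      (l r 1 / levelDen T g r 1 * (levelTail v T g N n r (T r) (fun m => F (m + v r)) -
        levelTail v T g N n r (T r) F) +
      l r (-1) / levelDen T g r (-1) * (levelTail v T g N n r (-T r - g r) (fun m => F (m - v r)) -
        levelTail v T g N n r (-T r - g r) F)) := by
  rw [← levelTail_sub, ← levelTail_sub, ← stepDiff_one, ← stepDiff_neg_one,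
    ← levelVal_neg_one T g r, ← levelVal_one T g r]
  rfl

lemma levelOp_linear_last (r : ℕ) (l₀ l₁ l₂ : ℕ → SignType → ℝ) (c₀ c₁ c₂ : ℝ)
    (F : (Fin p → ℤ) → ℝ) :
    levelOp v T g N n r (fun i s => c₀ * l₀ i s + c₁ * l₁ i s + c₂ * l₂ i s) F =
      c₀ * levelOp v T g N n r l₀ F + c₁ * levelOp v T g N n r l₁ F +
        c₂ * levelOp v T g N n r l₂ F :=
  chainOp_linear_last ..

lemma levelPair_div_levelDen_one (z : ℝ) (r : ℕ) :
    levelPair T g z r 1 / levelDen T g r 1 =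
      (z + T r + g r) * (z + T r + g r + 1) / ((2 * T r + g r) * (2 * T r + g r + 1)) := by
  rw [levelPair, levelDen, levelVal_one]

lemma levelPair_div_levelDen_neg_one (z : ℝ) (r : ℕ) :
    levelPair T g z r (-1) / levelDen T g r (-1) =
      (z - T r) * (z - T r + 1) / ((2 * T r + g r) * (2 * T r + g r - 1)) := by
  rw [levelPair, levelDen, levelVal_neg_one]
  congr 1 <;> ring

lemma levelEnd_div_levelDen_one (r : ℕ) :
    levelEnd T g (r + 1) r 1 / levelDen T g r 1 =
      (T r + g r + T (r + 1)) * (T (r + 1) + g (r + 1) - T r - g r) /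
        ((2 * T r + g r) * (2 * T r + g r + 1)) := by
  rw [levelEnd, levelDen, levelVal_one]

lemma levelEnd_div_levelDen_neg_one (r : ℕ) :
    levelEnd T g (r + 1) r (-1) / levelDen T g r (-1) =
      (T (r + 1) - T r) * (T (r + 1) + g (r + 1) + T r) /
        ((2 * T r + g r) * (2 * T r + g r - 1)) := by
  rw [levelEnd, levelDen, levelVal_neg_one]
  congr 1 <;> ring

variable {T g} {r : ℕ}

/-- The three denominators at the level `r` do not vanish. -/
def IsRegularLevel (T g : ℕ → ℝ) (r : ℕ) : Prop :=
  2 * T r + g r - 1 ≠ 0 ∧ 2 * T r + g r ≠ 0 ∧ 2 * T r + g r + 1 ≠ 0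

-- Both sides are monic quadratic polynomials in `z` which agree at the nodes `T r`, `-T r - g r`.
lemma levelPair_eq_interpolation (h : IsRegularLevel T g r) (z : ℝ) :
    levelPair T g z = fun i s =>
      levelPair T g z r 1 / levelDen T g r 1 * levelPair T g (T r) i s +
      2 * (z - T r) * (z + T r + g r) / ((2 * T r + g r - 1) * (2 * T r + g r + 1)) *
        levelEnd T g r i s +
      levelPair T g z r (-1) / levelDen T g r (-1) * levelPair T g (-T r - g r) i s := by
  obtain ⟨h₁, h₂, h₃⟩ := h
  ext i s
  rw [levelPair_div_levelDen_one, levelPair_div_levelDen_neg_one]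
  simp only [levelPair, levelEnd]
  generalize hZ : 2 * T r + g r = Z at *
  rw [show g r = Z - 2 * T r by linarith]
  field_simp
  ring

lemma levelEnd_succ_eq_interpolation (h : IsRegularLevel T g r) :
    levelEnd T g (r + 1) = fun i s =>
      levelEnd T g (r + 1) r 1 / levelDen T g r 1 * levelPair T g (T r) i s +
      (1 + levelEnd T g (r + 1) r 1 / levelDen T g r 1 +
        levelEnd T g (r + 1) r (-1) / levelDen T g r (-1)) * levelEnd T g r i s +
      levelEnd T g (r + 1) r (-1) / levelDen T g r (-1) * levelPair T g (-T r - g r) i s := by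
  obtain ⟨h₁, h₂, h₃⟩ := h
  ext i s
  rw [levelEnd_div_levelDen_one, levelEnd_div_levelDen_neg_one]
  simp only [levelPair, levelEnd]
  generalize hZ : 2 * T r + g r = Z at *
  rw [show g r = Z - 2 * T r by linarith]
  field_simp
  ring

lemma levelTail_succ (h : IsRegularLevel T g r) (z : ℝ) (F : (Fin p → ℤ) → ℝ) :
    levelTail v T g N n (r + 1) z F =
      (z + T r + g r) * (z + T r + g r + 1) / ((2 * T r + g r) * (2 * T r + g r + 1)) *
        levelTail v T g N n r (T r) (fun m => F (m + v r)) +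
      2 * (z - T r) * (z + T r + g r) / ((2 * T r + g r - 1) * (2 * T r + g r + 1)) *
        (levelOp v T g N n r (levelEnd T g r) F - (N + (1 + g r) / 2) * F n) +
      (z - T r) * (z - T r + 1) / ((2 * T r + g r) * (2 * T r + g r - 1)) *
        levelTail v T g N n r (-T r - g r) (fun m => F (m - v r)) := by
  have hpair := levelPair_eq_interpolation h z
  have hscalar : N - z - levelPair T g z r 1 / levelDen T g r 1 * (N - T r) -
      levelPair T g z r (-1) / levelDen T g r (-1) * (N - (-T r - g r)) =
      -(2 * (z - T r) * (z + T r + g r) / ((2 * T r + g r - 1) * (2 * T r + g r + 1))) *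
        (N + (1 + g r) / 2) := by
    obtain ⟨h₁, h₂, h₃⟩ := h
    rw [levelPair_div_levelDen_one, levelPair_div_levelDen_neg_one]
    clear hpair
    generalize hZ : 2 * T r + g r = Z at *
    rw [show g r = Z - 2 * T r by linarith]
    field_simp
    ring
  rw [levelTail, levelOp_succ, show levelOp v T g N n r (levelPair T g z) F = _ from
      congrArg (levelOp v T g N n r · F) hpair,
    levelOp_linear_last, ← levelPair_div_levelDen_one, ← levelPair_div_levelDen_neg_one]
  simp only [levelTail]
  linear_combination F n * hscalar

lemma levelOp_succ_end (h : IsRegularLevel T g r) (F : (Fin p → ℤ) → ℝ) :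
    levelOp v T g N n (r + 1) (levelEnd T g (r + 1)) F =
      levelOp v T g N n r (levelEnd T g r) F +
      (T r + g r + T (r + 1)) * (T (r + 1) + g (r + 1) - T r - g r) /
        ((2 * T r + g r) * (2 * T r + g r + 1)) *
        (levelOp v T g N n r (levelEnd T g r) F - (N - T r) * F n +
          levelTail v T g N n r (T r) (fun m => F (m + v r))) +
      (T (r + 1) - T r) * (T (r + 1) + g (r + 1) + T r) /
        ((2 * T r + g r) * (2 * T r + g r - 1)) *
        (levelOp v T g N n r (levelEnd T g r) F - (N + T r + g r) * F n +
          levelTail v T g N n r (-T r - g r) (fun m => F (m - v r))) := by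
  rw [levelOp_succ, show levelOp v T g N n r (levelEnd T g (r + 1)) F = _ from
      congrArg (levelOp v T g N n r · F) (levelEnd_succ_eq_interpolation h),
    levelOp_linear_last, ← levelEnd_div_levelDen_one, ← levelEnd_div_levelDen_neg_one]
  simp only [levelTail]
  ring

end Level

/-! ### Operators in `n` on products of Hahn polynomials -/

section Step

variable {p : ℕ} {v : ℕ → Fin p → ℤ} {T g : ℕ → ℝ} {N : ℝ} {n : Fin p → ℤ} {r k : ℕ}
  {x a b M G : ℝ} {F : (Fin p → ℤ) → ℝ}

lemma IsRegularLevel.denominators_ne_zero (hreg : IsRegularLevel T g r)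
    (hz : 2 * T r + g r = 2 * k + a + b + 1) :
    2 * k + a + b ≠ 0 ∧ 2 * k + a + b + 1 ≠ 0 ∧ 2 * k + a + b + 2 ≠ 0 := by
  obtain ⟨h₁, h₂, h₃⟩ := hreg
  rw [hz] at h₁ h₂ h₃
  exact ⟨by convert h₁ using 1; ring, h₂, by convert h₃ using 1; ring⟩

lemma levelOp_succ_end_of_hahnN (hreg : IsRegularLevel T g r) (hT : T r = T (r + 1) + k)
    (ha : g (r + 1) = a - 2 * T (r + 1)) (hg : g r = a - 2 * T (r + 1) + b + 1)
    (hb : poch (b + 1) (k + 1) ≠ 0) (hval : F n = hahnN k x a b M * G)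
    (heigen : levelOp v T g N n r (levelEnd T g r) F =
      (N - (M + T (r + 1))) * (hahnN k x a b M * G))
    (hraise : levelTail v T g N n r (T r) (fun m => F (m + v r)) = hahnN (k + 1) x a b M * G)
    (hlower : 1 ≤ k → levelTail v T g N n r (-T r - g r) (fun m => F (m - v r)) =
      (M - k + 1) * (M + k + a + b + 1) * (hahnN (k - 1) x a b M * G)) :
    levelOp v T g N n (r + 1) (levelEnd T g (r + 1)) F =
      (N - (x + T (r + 1))) * (hahnN k x a b M * G) := by
  obtain ⟨h₀, h₁, h₂⟩ := hreg.denominators_ne_zero (k := k) (a := a) (b := b) (by rw [hT, hg]; ring)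
  have hrec := hahnN_three_term x a M h₀ h₁ h₂ hb
  have hlower' : k * levelTail v T g N n r (-T r - g r) (fun m => F (m - v r)) =
      k * ((M - k + 1) * (M + k + a + b + 1) * (hahnN (k - 1) x a b M * G)) := by
    obtain rfl | hk := k.eq_zero_or_pos
    · simp
    · rw [hlower hk]
  rw [levelOp_succ_end v N n hreg, heigen, hval, hraise]
  generalize levelTail v T g N n r (-T r - g r) (fun m => F (m - v r)) = t at hlower' ⊢
  rw [ha, hg, hT] at *
  linear_combination G * hrec - (a + k) / ((2 * k + a + b) * (2 * k + a + b + 1)) * hlower'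

lemma levelTail_succ_of_hahnN_raise (hreg : IsRegularLevel T g r) (hT : T r = T (r + 1) + k)
    (hg : g r = a - 2 * T (r + 1) + b + 1) (hb : poch (b + 1) k ≠ 0)
    (hraise : levelTail v T g N n r (T r) (fun m => F (m + v r)) =
      hahnN k (x - 1) (a + 2) b (M - 1) * G)
    (hval : 1 ≤ k → F n = hahnN (k - 1) (x - 1) (a + 2) b (M - 1) * G)
    (heigen : 1 ≤ k → levelOp v T g N n r (levelEnd T g r) F =
      (N - (M + T (r + 1))) * (hahnN (k - 1) (x - 1) (a + 2) b (M - 1) * G))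
    (hlower : 2 ≤ k → levelTail v T g N n r (-T r - g r) (fun m => F (m - v r)) =
      (M - k + 1) * (M + k + a + b + 1) * (hahnN (k - 2) (x - 1) (a + 2) b (M - 1) * G)) :
    levelTail v T g N n (r + 1) (T (r + 1)) F = hahnN k x a b M * G := by
  obtain ⟨h₀, h₁, h₂⟩ := hreg.denominators_ne_zero (k := k) (a := a) (b := b) (by rw [hT, hg]; ring)
  have hrec := hahnN_three_term_raise x a M h₀ h₁ h₂ hb
  have heigen' : k * (levelOp v T g N n r (levelEnd T g r) F - (N + (1 + g r) / 2) * F n) =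
      k * ((N - (M + T (r + 1)) - (N + (1 + g r) / 2)) *
        (hahnN (k - 1) (x - 1) (a + 2) b (M - 1) * G)) := by
    obtain rfl | hk := k.eq_zero_or_pos
    · simp
    · rw [hval hk, heigen hk, ← sub_mul]
  have hlower' : k * (k - 1) * levelTail v T g N n r (-T r - g r) (fun m => F (m - v r)) =
      k * (k - 1) * ((M - k + 1) * (M + k + a + b + 1) *
        (hahnN (k - 2) (x - 1) (a + 2) b (M - 1) * G)) := by
    obtain hk | hk := lt_or_ge k 2
    · interval_cases k <;> simp
    · rw [hlower hk]
  rw [levelTail_succ v N n hreg, hraise]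
  generalize levelTail v T g N n r (-T r - g r) (fun m => F (m - v r)) = t at hlower' ⊢
  generalize levelOp v T g N n r (levelEnd T g r) F - (N + (1 + g r) / 2) * F n = u at heigen' ⊢
  rw [hg, hT] at *
  linear_combination G * hrec + 1 / ((2 * k + a + b) * (2 * k + a + b + 1)) * hlower' -
    2 * (k + a + b + 1) / ((2 * k + a + b) * (2 * k + a + b + 2)) * heigen'

lemma levelTail_succ_of_hahnN_lower (hreg : IsRegularLevel T g r) (hT : T r = T (r + 1) + k)
    (ha : g (r + 1) = a - 2 * T (r + 1)) (hg : g r = a - 2 * T (r + 1) + b + 1)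
    (hb : poch (b + 1) (k + 2) ≠ 0)
    (hraise : levelTail v T g N n r (T r) (fun m => F (m + v r)) =
      hahnN (k + 2) (x + 1) (a - 2) b (M + 1) * G)
    (hval : F n = hahnN (k + 1) (x + 1) (a - 2) b (M + 1) * G)
    (heigen : levelOp v T g N n r (levelEnd T g r) F =
      (N - (M + T (r + 1))) * (hahnN (k + 1) (x + 1) (a - 2) b (M + 1) * G))
    (hlower : levelTail v T g N n r (-T r - g r) (fun m => F (m - v r)) =
      (M - k + 1) * (M + k + a + b + 1) * (hahnN k (x + 1) (a - 2) b (M + 1) * G)) :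
    levelTail v T g N n (r + 1) (-T (r + 1) - g (r + 1)) F =
      (x + 1) * (x + a) * (hahnN k x a b M * G) := by
  obtain ⟨h₀, h₁, h₂⟩ := hreg.denominators_ne_zero (k := k) (a := a) (b := b) (by rw [hT, hg]; ring)
  have hrec := hahnN_three_term_lower x a M h₀ h₁ h₂ hb
  rw [levelTail_succ v N n hreg, hraise, hval, heigen, hlower, ha, hg, hT]
  linear_combination G * hrec

end Step

/-- The data of the product `H_p(n;y;γ;N)` read from its last factor to its first: the level `i` is
the factor number `p - i`. Here `S i = N_1^{p-i}`, `k i = n_{p-i}`, `g i = γ_1^{p-i+1} + p - i`,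
`b i = γ_{p-i+1}`, `Y i = Y_1^{p-i+1}`, and `top e` is the factor `(-1)^m / (-N)_m` for
`m = |n| + e`. The laws are those needed for an operator in the first `j` translations. -/
structure HahnLevels (p j : ℕ) where
  v : ℕ → Fin p → ℤ
  n : Fin p → ℤ
  N : ℝ
  S : ℕ → ℕ
  k : ℕ → ℕ
  g : ℕ → ℝ
  b : ℕ → ℝ
  Y : ℕ → ℝ
  top : ℤ → ℝ
  S_eq_add : ∀ i < j, S i = S (i + 1) + k i
  g_eq_add : ∀ i < j, g i = g (i + 1) + b i + 1
  isRegularLevel : ∀ i < j, IsRegularLevel (fun i => (S i : ℝ)) g i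
  poch_ne_zero : ∀ i < j, poch (b i + 1) (S 0 + 1) ≠ 0
  Y_zero : Y 0 = N
  top_one : (N - S 0) * top 1 = top 0
  top_neg_one : 1 ≤ S 0 → top (-1) = (N - S 0 + 1) * top 0

namespace HahnLevels

variable {p j : ℕ} (D : HahnLevels p j)

/-- The factor of the product at the level `r`, with index `k`, when the partial sum `S (r + 1)` is
shifted by `e`. -/
def factor (r k : ℕ) (e : ℤ) : ℝ :=
  hahnN k (D.Y (r + 1) - D.S (r + 1) - e) (2 * (D.S (r + 1) + e) + D.g (r + 1)) (D.b r)
    (D.Y r - D.S (r + 1) - e)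

lemma factor_zero (r k : ℕ) : D.factor r k 0 = hahnN k (D.Y (r + 1) - D.S (r + 1))
    (2 * D.S (r + 1) + D.g (r + 1)) (D.b r) (D.Y r - D.S (r + 1)) := by
  simp [factor]

lemma factor_one (r k : ℕ) : D.factor r k 1 = hahnN k (D.Y (r + 1) - D.S (r + 1) - 1)
    (2 * D.S (r + 1) + D.g (r + 1) + 2) (D.b r) (D.Y r - D.S (r + 1) - 1) := by
  rw [factor, Int.cast_one]
  congr 1
  ring

lemma factor_neg_one (r k : ℕ) : D.factor r k (-1) = hahnN k (D.Y (r + 1) - D.S (r + 1) + 1)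
    (2 * D.S (r + 1) + D.g (r + 1) - 2) (D.b r) (D.Y r - D.S (r + 1) + 1) := by
  rw [factor, Int.cast_neg, Int.cast_one, sub_neg_eq_add, sub_neg_eq_add]
  congr 1
  ring

/-- On the span of the first `r` translations at the point `n`, the function `F` is `C` times the
product of the factors at the levels below `r`, with the partial sum `S r` shifted by `e`. Nothing
is required of the values of `F` at which an index of a factor would be negative. -/
def IsProductForm : ℕ → ℤ → ℝ → ((Fin p → ℤ) → ℝ) → Prop
  | 0, e, C, F => F D.n = C * D.top e
  | r + 1, e, C, F => ∀ (δ : ℤ) (k : ℕ), (k : ℤ) = D.k r + δ - e →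
      IsProductForm r δ (C * D.factor r k e) (fun m => F (m + δ • D.v r))

/-- The unshifted product of the levels below `r`. -/
def prod (r : ℕ) : ℝ := D.top 0 * ∏ i ∈ range r, D.factor i (D.k i) 0

lemma prod_succ (r : ℕ) : D.prod (r + 1) = D.factor r (D.k r) 0 * D.prod r := by
  rw [prod, prod, prod_range_succ]
  ring

/-- `levelOp` with the weights of `𝔏̃^n_r`, for the data `D`. -/
def op (r : ℕ) : ((Fin p → ℤ) → ℝ) → ℝ :=
  levelOp D.v (fun i => (D.S i : ℝ)) D.g D.N D.n r (levelEnd (fun i => (D.S i : ℝ)) D.g r)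

/-- `levelTail` for the data `D`. -/
def tail (r : ℕ) (z : ℝ) : ((Fin p → ℤ) → ℝ) → ℝ :=
  levelTail D.v (fun i => (D.S i : ℝ)) D.g D.N D.n r z

/-- The evaluations of the operators of level `r` on products. The partial sum `S r` is unshifted in
`value` and `eigen`, and shifted by `1` and `-1` in `raise` and `lower`. -/
structure Evaluates (r : ℕ) : Prop where
  value : ∀ {C F}, D.IsProductForm r 0 C F → F D.n = C * D.prod r
  eigen : ∀ {C F}, D.IsProductForm r 0 C F → D.op r F = (D.N - D.Y r) * (C * D.prod r)
  raise : ∀ {C F}, D.IsProductForm r 1 C F → D.tail r (D.S r) F = C * D.prod r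
  lower : 1 ≤ D.S r → ∀ {C F}, D.IsProductForm r (-1) C F →
    D.tail r (-D.S r - D.g r) F =
      (D.Y r - D.S r + 1) * (D.Y r + D.S r + D.g r) * (C * D.prod r)

lemma evaluates_zero : D.Evaluates 0 where
  value {C F} hF := by
    have hF : F D.n = C * D.top 0 := hF
    rw [hF, prod, range_zero, prod_empty, mul_one]
  eigen _ := by simp [op, levelOp, chainOp, D.Y_zero]
  raise {C F} hF := by
    have hF : F D.n = C * D.top 1 := hF
    simp only [tail, levelTail, levelOp, chainOp, hF, prod, range_zero, prod_empty]
    linear_combination C * D.top_one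
  lower hS {C F} hF := by
    have hF : F D.n = C * D.top (-1) := hF
    simp only [tail, levelTail, levelOp, chainOp, hF, prod, range_zero, prod_empty,
      D.top_neg_one hS, D.Y_zero]
    ring

lemma S_le_S_zero {r : ℕ} (hr : r ≤ j) : D.S r ≤ D.S 0 := by
  induction r with
  | zero => exact le_rfl
  | succ r ih =>
    have hS := D.S_eq_add r hr
    have hle := ih (by omega)
    omega

section Succ

variable {D} {r : ℕ} {e : ℤ} {C : ℝ} {F : (Fin p → ℤ) → ℝ}

lemma cast_S_eq_add (hr : r < j) : (D.S r : ℝ) = D.S (r + 1) + D.k r := by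
  exact_mod_cast D.S_eq_add r hr

lemma poch_ne_zero_of_le_S_zero (hr : r < j) {m : ℕ} (hm : m ≤ D.S 0 + 1) :
    poch (D.b r + 1) m ≠ 0 :=
  poch_ne_zero_of_le hm (D.poch_ne_zero r hr)

lemma Evaluates.value_succ (h : D.Evaluates r) (hF : D.IsProductForm (r + 1) e C F) {k : ℕ}
    (hk : (k : ℤ) = D.k r - e) : F D.n = D.factor r k e * (C * D.prod r) := by
  have hval := h.value (hF 0 k (by omega))
  rw [zero_smul, add_zero] at hval
  rw [hval]
  ring

lemma Evaluates.eigen_succ (h : D.Evaluates r) (hF : D.IsProductForm (r + 1) e C F) {k : ℕ}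
    (hk : (k : ℤ) = D.k r - e) :
    D.op r F = (D.N - D.Y r) * (D.factor r k e * (C * D.prod r)) := by
  have heigen := h.eigen (hF 0 k (by omega))
  simp only [zero_smul, add_zero] at heigen
  rw [heigen]
  ring

lemma Evaluates.raise_succ (h : D.Evaluates r) (hF : D.IsProductForm (r + 1) e C F) {k : ℕ}
    (hk : (k : ℤ) = D.k r + 1 - e) :
    D.tail r (D.S r) (fun m => F (m + D.v r)) = D.factor r k e * (C * D.prod r) := by
  have hraise := h.raise (hF 1 k hk)
  simp only [one_smul] at hraise
  rw [hraise]
  ring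

lemma Evaluates.lower_succ (h : D.Evaluates r) (hr : r < j) (hS : 1 ≤ D.S r)
    (hF : D.IsProductForm (r + 1) e C F) {k : ℕ} (hk : (k : ℤ) = D.k r - 1 - e) :
    D.tail r (-D.S r - D.g r) (fun m => F (m - D.v r)) =
      (D.Y r - D.S (r + 1) - D.k r + 1) *
        (D.Y r - D.S (r + 1) + D.k r + (2 * D.S (r + 1) + D.g (r + 1)) + D.b r + 1) *
        (D.factor r k e * (C * D.prod r)) := by
  have hlower := h.lower hS (hF (-1) k (by omega))
  simp only [neg_smul, one_smul, ← sub_eq_add_neg] at hlower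
  rw [hlower, cast_S_eq_add hr, D.g_eq_add r hr]
  ring

lemma Evaluates.op_succ (h : D.Evaluates r) (hr : r < j) (hF : D.IsProductForm (r + 1) 0 C F) :
    D.op (r + 1) F = (D.N - D.Y (r + 1)) * (C * D.prod (r + 1)) := by
  have hS := D.S_eq_add r hr
  have hS₀ := D.S_le_S_zero hr.le
  have hstep := levelOp_succ_end_of_hahnN (x := D.Y (r + 1) - D.S (r + 1))
    (a := 2 * D.S (r + 1) + D.g (r + 1)) (b := D.b r) (M := D.Y r - D.S (r + 1))
    (G := C * D.prod r) (D.isRegularLevel r hr) (cast_S_eq_add hr) (by ring)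
    (by rw [D.g_eq_add r hr]; ring) (poch_ne_zero_of_le_S_zero hr (by omega))
    (by rw [← factor_zero]; exact h.value_succ hF (by omega))
    (by rw [sub_add_cancel, ← factor_zero]; exact h.eigen_succ hF (by omega))
    (by rw [← factor_zero]; exact h.raise_succ hF (by push_cast; omega))
    (fun hk => by rw [← factor_zero]; exact h.lower_succ hr (by omega) hF (by omega))
  rw [sub_add_cancel, ← factor_zero] at hstep
  refine hstep.trans ?_
  rw [prod_succ]
  ring

lemma Evaluates.tail_succ_raise (h : D.Evaluates r) (hr : r < j)
    (hF : D.IsProductForm (r + 1) 1 C F) :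
    D.tail (r + 1) (D.S (r + 1)) F = C * D.prod (r + 1) := by
  have hS := D.S_eq_add r hr
  have hS₀ := D.S_le_S_zero hr.le
  have hstep := levelTail_succ_of_hahnN_raise (x := D.Y (r + 1) - D.S (r + 1))
    (a := 2 * D.S (r + 1) + D.g (r + 1)) (b := D.b r) (M := D.Y r - D.S (r + 1))
    (G := C * D.prod r) (D.isRegularLevel r hr) (cast_S_eq_add hr)
    (by rw [D.g_eq_add r hr]; ring) (poch_ne_zero_of_le_S_zero hr (by omega))
    (by rw [← factor_one]; exact h.raise_succ hF (by omega))
    (fun hk => by rw [← factor_one]; exact h.value_succ hF (by omega))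
    (fun hk => by rw [sub_add_cancel, ← factor_one]; exact h.eigen_succ hF (by omega))
    (fun hk => by rw [← factor_one]; exact h.lower_succ hr (by omega) hF (by omega))
  refine hstep.trans ?_
  rw [prod_succ, factor_zero]
  ring

lemma Evaluates.tail_succ_lower (h : D.Evaluates r) (hr : r < j) (hS₁ : 1 ≤ D.S (r + 1))
    (hF : D.IsProductForm (r + 1) (-1) C F) :
    D.tail (r + 1) (-D.S (r + 1) - D.g (r + 1)) F =
      (D.Y (r + 1) - D.S (r + 1) + 1) * (D.Y (r + 1) + D.S (r + 1) + D.g (r + 1)) *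
        (C * D.prod (r + 1)) := by
  have hS := D.S_eq_add r hr
  have hS₀ := D.S_le_S_zero hr.le
  have hstep := levelTail_succ_of_hahnN_lower (x := D.Y (r + 1) - D.S (r + 1))
    (a := 2 * D.S (r + 1) + D.g (r + 1)) (b := D.b r) (M := D.Y r - D.S (r + 1))
    (G := C * D.prod r) (D.isRegularLevel r hr) (cast_S_eq_add hr) (by ring)
    (by rw [D.g_eq_add r hr]; ring) (poch_ne_zero_of_le_S_zero hr (by omega))
    (by rw [← factor_neg_one]; exact h.raise_succ hF (by push_cast; omega))
    (by rw [← factor_neg_one]; exact h.value_succ hF (by push_cast; omega))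
    (by rw [sub_add_cancel, ← factor_neg_one]; exact h.eigen_succ hF (by push_cast; omega))
    (by rw [← factor_neg_one]; exact h.lower_succ hr (by omega) hF (by omega))
  refine hstep.trans ?_
  rw [prod_succ, factor_zero]
  ring

end Succ

lemma evaluates {r : ℕ} (hr : r ≤ j) : D.Evaluates r := by
  induction r with
  | zero => exact D.evaluates_zero
  | succ r ih =>
    have h := ih (by omega)
    refine ⟨fun hF => ?_, fun hF => h.op_succ hr hF, fun hF => h.tail_succ_raise hr hF,
      fun hS _ _ hF => h.tail_succ_lower hr hS hF⟩
    rw [h.value_succ hF (sub_zero _).symm, prod_succ]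
    ring

lemma op_eq_mul {r : ℕ} (hr : r ≤ j) {C : ℝ} {F : (Fin p → ℤ) → ℝ}
    (hF : D.IsProductForm r 0 C F) : D.op r F = (D.N - D.Y r) * F D.n := by
  rw [(D.evaluates hr).eigen hF, (D.evaluates hr).value hF]

end HahnLevels

/-! ### The Hahn polynomials as functions of `n` -/

section ProductForm

variable {p : ℕ} (n : Fin p → ℕ) (γ : Fin (p + 1) → ℝ) (N : ℝ) (y : Fin p → ℝ)

/-- The prefactor `(-1)^m / (-N)_m` of `H_p`, for `m = t + e`. -/
def topFactor (N : ℝ) (t : ℕ) (e : ℤ) : ℝ := (-1) ^ (t + e).toNat / poch (-N) (t + e).toNat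

lemma topFactor_natCast (N : ℝ) (t e : ℕ) :
    topFactor N t e = (-1) ^ (t + e) / poch (-N) (t + e) := rfl

lemma mul_topFactor_one {N : ℝ} {t : ℕ} (h : poch (-N) (t + 1) ≠ 0) :
    (N - t) * topFactor N t 1 = topFactor N t 0 := by
  rw [← Nat.cast_one, ← Nat.cast_zero, topFactor_natCast, topFactor_natCast, add_zero]
  rw [poch_succ] at h ⊢
  have h₁ := left_ne_zero_of_mul h
  have h₂ := right_ne_zero_of_mul h
  field_simp
  ring

lemma topFactor_neg_one {N : ℝ} {t : ℕ} (ht : 1 ≤ t) (h : poch (-N) t ≠ 0) :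
    topFactor N t (-1) = (N - t + 1) * topFactor N t 0 := by
  obtain ⟨t, rfl⟩ := Nat.exists_eq_add_of_le' ht
  have hpred : topFactor N (t + 1) (-1) = topFactor N t 0 := by
    rw [topFactor, topFactor, show ((t + 1 : ℕ) + -1 : ℤ) = t + 0 by push_cast; ring]
  have hsucc : topFactor N (t + 1) 0 = topFactor N t 1 := by
    rw [topFactor, topFactor, show ((t + 1 : ℕ) + 0 : ℤ) = t + 1 by push_cast; ring]
  rw [hpred, hsucc, ← mul_topFactor_one h]
  push_cast
  ring

/-- The factor number `k + 1` of `H_p`, including its normalization. -/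
def normalizedFactor (m : ℕ → ℕ) (γ y : ℕ → ℝ) (k : ℕ) : ℝ :=
  hahnN (m k) (partialSum y (k + 1) - partialSum m k)
    (2 * partialSum m k + partialSum γ (k + 1) + k) (γ (k + 1))
    (partialSum y (k + 2) - partialSum m k)

lemma hahnH_eq_mul_prod_normalizedFactor (m : ℕ → ℕ) :
    hahnH (fun i : Fin p => m i) y γ N =
      (-1) ^ partialSum m p / poch (-N) (partialSum m p) *
        ∏ k ∈ range p, normalizedFactor m (zeroExtend γ) (zeroExtend (compl y N)) k := by
  have hsum : ∀ k ≤ p, psum (fun i : Fin p => ((m i : ℕ) : ℝ)) k = (partialSum m k : ℕ) := by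
    intro k hk
    rw [psum_natCast]
    refine congrArg _ (sum_congr rfl fun i hi => ?_)
    exact dif_pos ((mem_range.1 hi).trans_le hk)
  have hfactor : ∀ k : Fin p,
      normalizedFactor m (zeroExtend γ) (zeroExtend (compl y N)) k =
        hahn1 (m k) (psum (compl y N) (k + 1) - psum (fun i : Fin p => ((m i : ℕ) : ℝ)) k)
          (2 * psum (fun i : Fin p => ((m i : ℕ) : ℝ)) k + psum γ (k + 1) + (k : ℝ)) (γ k.succ)
          (psum (compl y N) (k + 2) - psum (fun i : Fin p => ((m i : ℕ) : ℝ)) k) /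
        poch (γ k.succ + 1) (m k) := by
    intro k
    rw [normalizedFactor, hahnN, hsum k k.is_lt.le, psum_eq_partialSum, psum_eq_partialSum,
      psum_eq_partialSum, ← zeroExtend_val γ k.succ, Fin.val_succ]
  rw [hahnH, Fin.sum_univ_eq_sum_range, prod_range, prod_congr rfl fun k _ => hfactor k,
    prod_div_distrib, partialSum, div_mul_div_comm, div_mul_eq_mul_div]

/-- The point of `ℤ^p` with entries `m` at the indices below `q`, and those of `n` from `q` on,
except that the entry at `q` is decreased by `e`. With `q = p - r` these are the points reached from
`n` by the first `r` translations, where `e` is the excess of the partial sum `N_1^q`. -/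
def splice (m : ℕ → ℕ) (q : ℕ) (e : ℤ) : Fin p → ℤ := fun i =>
  if (i : ℕ) < q then (m i : ℤ) else n i - if (i : ℕ) = q then e else 0

lemma splice_add_smul_dualShift {r k : ℕ} {m : ℕ → ℕ} {e δ : ℤ} (hr : r < p)
    (hk : (k : ℤ) = zeroExtend n (p - (r + 1)) + δ - e) :
    splice n m (p - (r + 1)) e + δ • dualShift p (r + 1) =
      splice n (Function.update m (p - (r + 1)) k) (p - r) δ := by
  obtain ⟨q, hq⟩ : ∃ q, p - (r + 1) = q := ⟨_, rfl⟩
  have hqr : p - r = q + 1 := by omega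
  rw [hq] at hk
  ext i
  simp only [hq, hqr, Pi.add_apply, Pi.smul_apply, smul_eq_mul, splice, dualShift,
    show p + 1 - (r + 1) = q + 1 by omega, show p + 2 - (r + 1) = q + 2 by omega]
  obtain hi | hi | hi | hi : (i : ℕ) < q ∨ (i : ℕ) = q ∨ (i : ℕ) = q + 1 ∨ q + 1 < (i : ℕ) := by
    omega
  · simp [hi, hi.ne, hi.trans q.lt_succ_self, show ¬(i : ℕ) = q + 1 by omega]
  · rw [← hi, zeroExtend_val] at hk
    simp [hi, hk]
    ring
  · simp [hi]
    ring
  · simp [show ¬(i : ℕ) < q by omega, show ¬(i : ℕ) = q by omega, show ¬(i : ℕ) = q + 1 by omega,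
      show ¬(i : ℕ) < q + 1 by omega]

lemma partialSum_update_of_le {R : Type*} [AddCommMonoid R] (m : ℕ → R) {q k : ℕ} (hk : k ≤ q)
    (t : R) : partialSum (Function.update m q t) k = partialSum m k :=
  sum_congr rfl fun _ hi => Function.update_of_ne ((mem_range.1 hi).trans_le hk).ne _ _

variable {n γ N}

lemma partialSum_zeroExtend_self {m : ℕ} {R : Type*} [AddCommMonoid R] (v : Fin m → R) :
    partialSum (zeroExtend v) m = ∑ i, v i := by
  rw [partialSum, sum_range]
  exact sum_congr rfl fun i _ => zeroExtend_val v i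

lemma partialSum_zeroExtend_compl_last :
    partialSum (zeroExtend (compl y N)) (p + 1) = N := by
  rw [partialSum_zeroExtend_self, Fin.sum_univ_castSucc]
  simp [compl]

lemma psum_compl_of_le {k : ℕ} (hk : k ≤ p) : psum (compl y N) k = psum y k := by
  have hlast : ¬p < k := hk.not_gt
  simp [psum, Fin.sum_univ_castSucc, compl, hlast]

lemma levelSum_natCast :
    levelSum (fun i => (n i : ℤ)) = fun i => ((partialSum (zeroExtend n) (p - i) : ℕ) : ℝ) := by
  funext i
  simp only [levelSum, Int.cast_natCast, psum_natCast]

lemma levelParam_eq_add {i : ℕ} (hi : i < p) :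
    levelParam γ i = levelParam γ (i + 1) + zeroExtend γ (p - i) + 1 := by
  obtain ⟨q, hq⟩ : ∃ q, p - (i + 1) = q := ⟨_, rfl⟩
  have hqi : p - i = q + 1 := by omega
  rw [levelParam, levelParam, psum_eq_partialSum, psum_eq_partialSum, hq, hqi,
    partialSum_succ _ (q + 1)]
  push_cast
  ring

lemma Regular.isRegularLevel {j i : ℕ} (h : Regular j n γ N) (hjp : j ≤ p) (hi : i < j) :
    IsRegularLevel (fun i => ((partialSum (zeroExtend n) (p - i) : ℕ) : ℝ)) (levelParam γ) i := by
  obtain ⟨h₁, h₂, h₃⟩ := h.2.2 (p - i) (by omega) (by omega)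
  rw [psum_natCast, add_assoc] at h₁ h₂ h₃
  exact ⟨sub_ne_zero.2 h₃, h₂, fun h₀ => h₁ (eq_neg_of_add_eq_zero_left h₀)⟩

lemma Regular.poch_zeroExtend_ne_zero {j k : ℕ} (h : Regular j n γ N) (hk : 0 < k) (hkp : k ≤ p) :
    poch (zeroExtend γ k + 1) ((∑ i, n i) + 1) ≠ 0 := by
  have hγ := h.2.1 ⟨k - 1, by omega⟩
  rwa [← zeroExtend_val γ, Fin.val_succ, Fin.val_mk, Nat.sub_add_cancel hk] at hγ

/-- The levels of `H_p(·;y;γ;N)` around `n`. -/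
def hahnLevels {j : ℕ} (hjp : j ≤ p) (hreg : Regular j n γ N) : HahnLevels p j where
  v i := dualShift p (i + 1)
  n i := n i
  N := N
  S i := partialSum (zeroExtend n) (p - i)
  k i := zeroExtend n (p - (i + 1))
  g := levelParam γ
  b i := zeroExtend γ (p - i)
  Y i := partialSum (zeroExtend (compl y N)) (p - i + 1)
  top := topFactor N (∑ i, n i)
  S_eq_add i hi := by rw [← partialSum_succ, show p - (i + 1) + 1 = p - i by omega]
  g_eq_add i hi := levelParam_eq_add (hi.trans_le hjp)
  isRegularLevel i hi := hreg.isRegularLevel hjp hi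
  poch_ne_zero i hi := by
    rw [Nat.sub_zero, partialSum_zeroExtend_self]
    exact hreg.poch_zeroExtend_ne_zero (by omega) (by omega)
  Y_zero := partialSum_zeroExtend_compl_last y
  top_one := by
    rw [Nat.sub_zero, partialSum_zeroExtend_self]
    exact mul_topFactor_one hreg.1
  top_neg_one := by
    rw [Nat.sub_zero, partialSum_zeroExtend_self]
    exact fun h => topFactor_neg_one h (poch_ne_zero_of_le (Nat.le_succ _) hreg.1)

lemma hahnExt_natCast (c : (Fin p → ℤ) → ℝ) (m : Fin p → ℕ) :
    hahnExt c y γ N (fun i => (m i : ℤ)) = hahnH m y γ N := by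
  simp [hahnExt]

variable {j : ℕ} (hjp : j ≤ p) (hreg : Regular j n γ N)

lemma hahnLevels_factor {r k : ℕ} (hr : r < p) {m : ℕ → ℕ} {e : ℤ}
    (hm : ((partialSum m (p - (r + 1)) : ℕ) : ℤ) =
      (partialSum (zeroExtend n) (p - (r + 1)) : ℕ) + e) :
    (hahnLevels y hjp hreg).factor r k e =
      normalizedFactor (Function.update m (p - (r + 1)) k) (zeroExtend γ)
        (zeroExtend (compl y N)) (p - (r + 1)) := by
  have hm' : ((partialSum m (p - (r + 1)) : ℕ) : ℝ) =
      (partialSum (zeroExtend n) (p - (r + 1)) : ℕ) + e := by exact_mod_cast hm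
  obtain ⟨q, hq⟩ : ∃ q, p - (r + 1) = q := ⟨_, rfl⟩
  have hqr : p - r = q + 1 := by omega
  simp only [HahnLevels.factor, hahnLevels, normalizedFactor, levelParam, psum_eq_partialSum, hq,
    hqr, Function.update_self, partialSum_update_of_le m le_rfl] at hm' ⊢
  rw [hm']
  congr 1 <;> ring

lemma isProductForm_hahnExt (c : (Fin p → ℤ) → ℝ) {r : ℕ} (hr : r ≤ p) {m : ℕ → ℕ} {e : ℤ}
    (hm : ((partialSum m (p - r) : ℕ) : ℤ) = (partialSum (zeroExtend n) (p - r) : ℕ) + e) :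
    (hahnLevels y hjp hreg).IsProductForm r e
      (∏ k ∈ range (p - r), normalizedFactor m (zeroExtend γ) (zeroExtend (compl y N)) k)
      (fun z => hahnExt c y γ N (z + (splice n m (p - r) e - fun i => (n i : ℤ)))) := by
  induction r generalizing m e with
  | zero =>
    rw [Nat.sub_zero] at hm ⊢
    have hsplice : splice n m p e = fun i : Fin p => (m i : ℤ) := by
      ext i
      simp [splice]
    rw [partialSum_zeroExtend_self] at hm
    simp only [HahnLevels.IsProductForm, hahnLevels, topFactor, hsplice, add_sub_cancel,
      hahnExt_natCast, hahnH_eq_mul_prod_normalizedFactor, ← hm, Int.toNat_natCast]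
    exact mul_comm _ _
  | succ r ih =>
    intro δ k hk
    have hq : p - r = p - (r + 1) + 1 := by omega
    have hsum : ((partialSum (Function.update m (p - (r + 1)) k) (p - r) : ℕ) : ℤ) =
        (partialSum (zeroExtend n) (p - r) : ℕ) + δ := by
      simp only [hq, partialSum_succ, partialSum_update_of_le m le_rfl, Function.update_self,
        Nat.cast_add, hm, hk, hahnLevels]
      ring
    have hprod : ∏ i ∈ range (p - r), normalizedFactor (Function.update m (p - (r + 1)) k)
          (zeroExtend γ) (zeroExtend (compl y N)) i =
        (∏ i ∈ range (p - (r + 1)),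
          normalizedFactor m (zeroExtend γ) (zeroExtend (compl y N)) i) *
        (hahnLevels y hjp hreg).factor r k e := by
      rw [hq, prod_range_succ, hahnLevels_factor y hjp hreg hr hm]
      congr 1
      refine prod_congr rfl fun i hi => ?_
      have hi := mem_range.1 hi
      rw [normalizedFactor, normalizedFactor, partialSum_update_of_le m hi.le,
        Function.update_of_ne hi.ne]
    have hform := ih (by omega) hsum
    rw [hprod, ← splice_add_smul_dualShift n hr hk] at hform
    convert hform using 3
    simp only [hahnLevels]
    module

lemma hahnOpN_hahnExt {j : ℕ} (hj : 1 ≤ j) (hjp : j ≤ p) (hreg : Regular j n γ N)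
    (c : (Fin p → ℤ) → ℝ) :
    hahnOpN j γ N (hahnExt c y γ N) (fun i => (n i : ℤ)) =
      (N - psum y (p + 1 - j)) * hahnH n y γ N := by
  have hsplice : splice n (zeroExtend n) (p - j) 0 = fun i => (n i : ℤ) := by
    ext i
    simp [splice, zeroExtend_val]
  have hform := isProductForm_hahnExt y hjp hreg c hjp (m := zeroExtend n) (add_zero _).symm
  simp only [hsplice, sub_self, add_zero] at hform
  have hend : p - j + 1 = p + 1 - j := by omega
  calc hahnOpN j γ N (hahnExt c y γ N) (fun i => (n i : ℤ))
      = (hahnLevels y hjp hreg).op j (hahnExt c y γ N) := by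
        rw [hahnOpN_eq_levelOp _ _ _ _ hjp, levelSum_natCast, HahnLevels.op, hahnLevels]
    _ = (N - partialSum (zeroExtend (compl y N)) (p - j + 1)) *
          hahnExt c y γ N (fun i => (n i : ℤ)) := (hahnLevels y hjp hreg).op_eq_mul le_rfl hform
    _ = (N - psum y (p + 1 - j)) * hahnH n y γ N := by
        rw [hahnExt_natCast, hend, ← psum_eq_partialSum, psum_compl_of_le y (by omega)]

end ProductForm

/-! ### Continuity in the parameters -/

section Continuity

lemma continuous_hahn1 {α : Type*} [TopologicalSpace α] (n : ℕ) {x a b M : α → ℝ}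
    (hx : Continuous x) (ha : Continuous a) (hb : Continuous b) (hM : Continuous M) :
    Continuous fun q => hahn1 n (x q) (a q) (b q) (M q) := by
  have hpoch (i : ℕ) {f : α → ℝ} (hf : Continuous f) : Continuous fun q => poch (f q) i :=
    (continuous_poch i).comp hf
  refine continuous_finsetSum _ fun k _ => ?_
  exact (((continuous_const.mul (hpoch _ (by fun_prop))).mul (hpoch _ (by fun_prop))).div_const
    _).mul ((hpoch _ (by fun_prop)).mul (hpoch _ (by fun_prop)))

lemma continuous_psum {m : ℕ} (k : ℕ) : Continuous fun v : Fin m → ℝ => psum v k := by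
  refine continuous_finsetSum _ fun i _ => ?_
  split_ifs <;> fun_prop

variable {p : ℕ} (n : Fin p → ℕ) {γ : Fin (p + 1) → ℝ} {N : ℝ} (y : Fin p → ℝ)

lemma continuous_compl : Continuous (compl y) :=
  Continuous.finSnoc continuous_const (by fun_prop)

lemma continuousAt_hahnH (hN : poch (-N) (∑ i, n i) ≠ 0)
    (hγ : ∀ k : Fin p, poch (γ k.succ + 1) (n k) ≠ 0) :
    ContinuousAt (fun q : (Fin (p + 1) → ℝ) × ℝ => hahnH n y q.1 q.2) (γ, N) := by
  have hpoch (k : ℕ) {f : (Fin (p + 1) → ℝ) × ℝ → ℝ} (hf : Continuous f) :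
      Continuous fun q => poch (f q) k := (continuous_poch k).comp hf
  have hpsum (k : ℕ) : Continuous fun q : (Fin (p + 1) → ℝ) × ℝ => psum q.1 k :=
    (continuous_psum k).comp continuous_fst
  have hcompl (k : ℕ) : Continuous fun q : (Fin (p + 1) → ℝ) × ℝ => psum (compl y q.2) k :=
    (continuous_psum k).comp ((continuous_compl y).comp continuous_snd)
  refine .mul (.div continuousAt_const ?_ ?_) (Continuous.continuousAt ?_)
  · exact ((hpoch _ (by fun_prop)).mul
      (continuous_finsetProd _ fun k _ => hpoch _ (by fun_prop))).continuousAt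
  · exact mul_ne_zero hN (prod_ne_zero_iff.2 fun k _ => hγ k)
  · refine continuous_finsetProd _ fun k _ => continuous_hahn1 _ ?_ ?_ (by fun_prop) ?_
    · exact (hcompl _).sub continuous_const
    · exact (continuous_const.add (hpsum _)).add continuous_const
    · exact (hcompl _).sub continuous_const

end Continuity

end Hahn

end

theorem theorem5p2 (p j : ℕ) (hj : 1 ≤ j) (hjp : j ≤ p)
    (γ : Fin (p + 1) → ℝ) (N : ℝ) (n : Fin p → ℕ)
    -- the polynomial `H_p(n;y;γ;N)` is defined (if `N ∈ ℕ` then `|n| ≤ N`)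
    (hN : ∀ M : ℕ, N = M → ∑ i, n i ≤ M)
    (hγ : ∀ k : Fin p, Hahn.poch (γ k.succ + 1) (n k) ≠ 0) :
    -- the spectral equation in `y`
    (∀ y : Fin p → ℝ,
      Hahn.hahnOpY j γ N (fun y' => Hahn.hahnH n y' γ N) y =
        -(Hahn.psum (fun i => (n i : ℝ)) j *
            (Hahn.psum (fun i => (n i : ℝ)) j + j + Hahn.psum γ (j + 1))) *
          Hahn.hahnH n y γ N) ∧
    -- the limit that defines the operator in `n` exists, and the spectral equation in `n` holds
    (Hahn.Regular j n γ N →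
      (∀ F : (Fin p → ℤ) → ℝ,
        Tendsto (fun β₀ : ℝ =>
            Hahn.racahDualOp j (Hahn.hahnParam γ β₀) N F (fun i => (n i : ℤ)) / β₀)
          atTop (𝓝 (Hahn.hahnOpN j γ N F (fun i => (n i : ℤ))))) ∧
      ∀ (c : (Fin p → ℤ) → ℝ) (y : Fin p → ℝ),
        Hahn.hahnOpN j γ N (Hahn.hahnExt c y γ N) (fun i => (n i : ℤ)) =
          (N - Hahn.psum y (p + 1 - j)) * Hahn.hahnH n y γ N) ∧
    -- at the other parameters, in particular for `N = |n|`, it holds in the limit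
    (∀ (c : (Fin p → ℤ) → ℝ) (y : Fin p → ℝ),
      Tendsto (fun q : (Fin (p + 1) → ℝ) × ℝ =>
          Hahn.hahnOpN j q.1 q.2 (Hahn.hahnExt c y q.1 q.2) (fun i => (n i : ℤ)))
        (𝓝[{q | Hahn.Regular j n q.1 q.2}] (γ, N))
        (𝓝 ((N - Hahn.psum y (p + 1 - j)) * Hahn.hahnH n y γ N))) := by
  refine ⟨fun y => Hahn.hahnOpY_hahnH hjp n γ N y, fun hreg => ⟨fun F => ?_, fun c y =>
    Hahn.hahnOpN_hahnExt y hj hjp hreg c⟩, fun c y => ?_⟩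
  · rw [Hahn.hahnOpN_eq_levelOp γ N _ F hjp]
    exact Hahn.tendsto_racahDualOp γ N _ F hjp
  · have hcont : ContinuousAt (fun q : (Fin (p + 1) → ℝ) × ℝ =>
        (q.2 - Hahn.psum y (p + 1 - j)) * Hahn.hahnH n y q.1 q.2) (γ, N) :=
      (continuous_snd.sub continuous_const).continuousAt.mul
        (Hahn.continuousAt_hahnH n y (Hahn.poch_neg_ne_zero hN) hγ)
    refine (hcont.tendsto.mono_left nhdsWithin_le_nhds).congr' ?_
    filter_upwards [self_mem_nhdsWithin] with q hq
    exact (Hahn.hahnOpN_hahnExt y hj hjp hq c).symm
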